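/- Let $T,\omega>0$ and let $\wp$ be the Weierstrass function of the rectangular lattice $\mathbb Z T+\mathbb Z\,2i\omega$, with invariants $g_2,g_3$. Consider the singular Lamé operator $L=-\partial_x^2+2\wp(x)$ on $[0,T]$ and the smooth $T$-periodic operator $L_{i\omega}=-\partial_x^2+2\wp(x+i\omega)$ on $\mathbb R$. The Hermit (Dirichlet) spectrum of $L$ is the set of $\lambda\in\mathbb C$ for which $L\psi=\lambda\psi$ on $(0,T)$ has a nonzero solution $\psi$, $C^2$ on $(0,T)$ and continuous on $[0,T]$, with $\psi(0)=\psi(T)=0$. For $u\in\mathbb C$ let $\hat T(u)$ be the monodromy operator $\psi(x)\mapsto\psi(x+T)$ on the space of solutions of $L_{i\omega}\psi=u\psi$ on $\mathbb R$, and let $S(u)=\tfrac12\operatorname{Tr}\hat T(u)$. A number $\lambda$ is a periodic/antiperiodic eigenvalue of $L_{i\omega}$ of multiplicity $m\ge 1$ if for one choice of the sign the space of solutions of $L_{i\omega}\psi=\lambda\psi$, $\psi(x+T)=\pm\psi(x)$, has dimension $m$; it is non-degenerate if $m=1$ and doubly degenerate if $m=2$. Then there are real numbers $u_0<u_1<u_2$,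 the finite branching points of the spectral curve (that is, $4u^3-g_2u+g_3=4(u-u_0)(u-u_1)(u-u_2)$, where $u=-\wp$), such that: 1. The Hermit spectrum of $L$ is simple: each of its eigenspaces is one-dimensional. 2. The Hermit spectrum of $L$ is exactly the set of doubly degenerate periodic/antiperiodic eigenvalues of $L_{i\omega}$. 3. It is exactly the set of points $u\in\mathbb C$ with $S(u)=\pm1$ and $S'(u)=0$. 4. It is an infinite set of real numbers $\lambda_1<\lambda_2<\dots$ (an increasing sequence which exhausts it), all of which exceed $u_2$. 5. The non-degenerate periodic/antiperiodic eigenvalues of $L_{i\omega}$ are exactly $u_0,u_1,u_2$. 6. $S(u)$ is real and $-1\le S(u)\le 1$ for all real $u\ge u_2$. -/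

import Mathlib

open Complex

noncomputable section

/-- The data of a rectangular period lattice `ℤ T + ℤ (2 i ω)` with `T, ω > 0`: `T` is the
minimal positive real period and `2 i ω` the minimal purely imaginary period. -/
structure RectPeriods where
  T : ℝ
  ω : ℝ
  T_pos : 0 < T
  ω_pos : 0 < ω

namespace RectPeriods

/-- The period pair `(T, 2 i ω)`. -/
def periodPair (P : RectPeriods) : PeriodPair where
  ω₁ := (P.T : ℂ)
  ω₂ := 2 * (P.ω : ℂ) * I
  indep := by
    rw [LinearIndependent.pair_iff]
    intro s t h
    have h1 := congrArg Complex.re h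
    have h2 := congrArg Complex.im h
    simp at h1 h2
    exact ⟨h1.resolve_right P.T_pos.ne', h2.resolve_right P.ω_pos.ne'⟩

/-- The potential `x ↦ 2 ℘(x + a)` on the real line, where `℘` is the Weierstrass function of the
lattice `ℤ T + ℤ (2 i ω)`. -/
def lamePotential (P : RectPeriods) (a : ℂ) (x : ℝ) : ℂ :=
  2 * P.periodPair.weierstrassP ((x : ℂ) + a)

theorem lamePotential_periodic (P : RectPeriods) (a : ℂ) :
    Function.Periodic (P.lamePotential a) P.T := by
  intro x
  have h := P.periodPair.periodic_weierstrassP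
    ⟨P.periodPair.ω₁, P.periodPair.ω₁_mem_lattice⟩ ((x : ℂ) + a)
  have e : ((x + P.T : ℝ) : ℂ) + a = (x : ℂ) + a + P.periodPair.ω₁ := by
    simp [periodPair]; ring
  simp only [lamePotential, e]
  rw [h]

end RectPeriods

/-- The differential expression `(-∂ₓ² + q) ψ`. -/
def schrodinger (q : ℝ → ℂ) (ψ : ℝ → ℂ) (x : ℝ) : ℂ :=
  -deriv (deriv ψ) x + q x * ψ x

theorem schrodinger_add {q ψ φ : ℝ → ℂ} {s : Set ℝ} (hs : IsOpen s) (hψ : ContDiffOn ℝ 2 ψ s)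
    (hφ : ContDiffOn ℝ 2 φ s) {x : ℝ} (hx : x ∈ s) :
    schrodinger q (ψ + φ) x = schrodinger q ψ x + schrodinger q φ x := by
  have d1 : ∀ {f : ℝ → ℂ}, ContDiffOn ℝ 2 f s → ∀ y ∈ s, DifferentiableAt ℝ f y :=
    fun hf y hy => (hf.differentiableOn (by norm_num)).differentiableAt (hs.mem_nhds hy)
  have d2 : ∀ {f : ℝ → ℂ}, ContDiffOn ℝ 2 f s → DifferentiableAt ℝ (deriv f) x :=
    fun hf => ((hf.deriv_of_isOpen (m := 1) hs (by norm_num)).differentiableOn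
      (by norm_num)).differentiableAt (hs.mem_nhds hx)
  have e : deriv (ψ + φ) =ᶠ[nhds x] deriv ψ + deriv φ := by
    filter_upwards [hs.mem_nhds hx] with y hy
    exact deriv_add (d1 hψ y hy) (d1 hφ y hy)
  simp only [schrodinger]
  rw [e.deriv_eq, deriv_add (d2 hψ) (d2 hφ), Pi.add_apply]
  ring

theorem schrodinger_smul {q ψ : ℝ → ℂ} (c : ℂ) (x : ℝ) :
    schrodinger q (c • ψ) x = c * schrodinger q ψ x := by
  have e : deriv (c • ψ) = c • deriv ψ := by
    funext y
    exact deriv_const_smul_field c ψ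
  simp only [schrodinger]
  rw [e, show deriv (c • deriv ψ) x = c • deriv (deriv ψ) x from deriv_const_smul_field c _]
  simp only [Pi.smul_apply, smul_eq_mul]
  ring

/-- The space of all `C²` solutions `ψ : ℝ → ℂ` of `-ψ'' + q ψ = μ ψ` on the whole real line. -/
def solutionSpace (q : ℝ → ℂ) (μ : ℂ) : Submodule ℂ (ℝ → ℂ) where
  carrier := {ψ | ContDiff ℝ 2 ψ ∧ ∀ x, schrodinger q ψ x = μ * ψ x}
  zero_mem' := by
    refine ⟨contDiff_const, fun x => ?_⟩
    have h := schrodinger_smul (q := q) (ψ := 0) 0 x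
    simpa using h
  add_mem' := by
    rintro ψ φ ⟨h1, h2⟩ ⟨h3, h4⟩
    refine ⟨h1.add h3, fun x => ?_⟩
    rw [schrodinger_add isOpen_univ h1.contDiffOn h3.contDiffOn (Set.mem_univ x), h2, h4,
      Pi.add_apply]
    ring
  smul_mem' := by
    rintro c ψ ⟨h1, h2⟩
    refine ⟨contDiff_const.smul h1, fun x => ?_⟩
    rw [schrodinger_smul, h2, Pi.smul_apply, smul_eq_mul]
    ring

/-- The translation `ψ(x) ↦ ψ(x + T)` of functions on the real line. -/
def translation (T : ℝ) : (ℝ → ℂ) →ₗ[ℂ] (ℝ → ℂ) where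
  toFun ψ := fun x => ψ (x + T)
  map_add' _ _ := rfl
  map_smul' _ _ := rfl

theorem translation_mem {q : ℝ → ℂ} {T : ℝ} (hq : Function.Periodic q T) (μ : ℂ) :
    ∀ ψ ∈ solutionSpace q μ, translation T ψ ∈ solutionSpace q μ := by
  rintro ψ ⟨h1, h2⟩
  refine ⟨h1.comp (contDiff_id.add contDiff_const), fun x => ?_⟩
  have e : ∀ f : ℝ → ℂ, deriv (fun y => f (y + T)) = fun y => deriv f (y + T) := fun f => by
    funext y
    exact deriv_comp_add_const f T y
  have h := h2 (x + T)
  simp only [schrodinger] at h ⊢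
  change -deriv (deriv (fun y => ψ (y + T))) x + q x * ψ (x + T) = μ * ψ (x + T)
  rw [e ψ, e (deriv ψ), ← hq x]
  exact h

/-- The monodromy operator `ψ(x) ↦ ψ(x + T)` on the solution space of `-ψ'' + q ψ = μ ψ`, for a
`T`-periodic potential `q`. -/
def monodromy {q : ℝ → ℂ} {T : ℝ} (hq : Function.Periodic q T) (μ : ℂ) :
    Module.End ℂ (solutionSpace q μ) :=
  (translation T).restrict (translation_mem hq μ)

namespace RectPeriods

/-- The monodromy operator, along the period `T`, of the smooth shifted operator
`L_{iω} = -∂ₓ² + 2 ℘(x + i ω)` at the spectral parameter `μ`. -/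
def shiftedMonodromy (P : RectPeriods) (μ : ℂ) :
    Module.End ℂ (solutionSpace (P.lamePotential (P.ω * I)) μ) :=
  monodromy (P.lamePotential_periodic (P.ω * I)) μ

/-- The half-trace `S(u)` of the monodromy operator. -/
def halfTrace (P : RectPeriods) (u : ℂ) : ℂ :=
  LinearMap.trace ℂ _ (P.shiftedMonodromy u) / 2

/-- The set of those `μ` for which, for one choice `ε` of the sign, the space of solutions of
`L_{iω} ψ = μ ψ`, `ψ(x + T) = ε ψ(x)` has dimension `m`. For `m ≥ 1` it consists of the
periodic/antiperiodic eigenvalues of multiplicity `m`. -/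
def periodicEigenvalues (P : RectPeriods) (m : ℕ) : Set ℂ :=
  {μ | ∃ ε : ℂ, (ε = 1 ∨ ε = -1) ∧
    Module.finrank ℂ ((P.shiftedMonodromy μ).eigenspace ε) = m}

/-- The eigenspace for the parameter `μ` of the singular operator `L = -∂ₓ² + 2 ℘(x)` on `[0, T]`
with zero boundary conditions: continuous functions on `[0, T]`, vanishing at `0` and at `T`, of
class `C²` on `(0, T)`, with `L ψ = μ ψ` on `(0, T)`. Functions on `[0, T]` that vanish at both
ends are represented by their extension by zero to the real line. -/
def hermitEigenspace (P : RectPeriods) (μ : ℂ) : Submodule ℂ (ℝ → ℂ) where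
  carrier := {ψ | (∀ x ∉ Set.Ioo 0 P.T, ψ x = 0) ∧ ContinuousOn ψ (Set.Icc 0 P.T) ∧
    ContDiffOn ℝ 2 ψ (Set.Ioo 0 P.T) ∧
    ∀ x ∈ Set.Ioo 0 P.T, schrodinger (P.lamePotential 0) ψ x = μ * ψ x}
  zero_mem' := by
    refine ⟨fun _ _ => rfl, continuousOn_const, contDiffOn_const, fun x _ => ?_⟩
    have h := schrodinger_smul (q := P.lamePotential 0) (ψ := 0) 0 x
    simpa using h
  add_mem' := by
    rintro ψ φ ⟨h1, h2, h3, h4⟩ ⟨k1, k2, k3, k4⟩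
    refine ⟨fun x hx => by simp [h1 x hx, k1 x hx], h2.add k2, h3.add k3, fun x hx => ?_⟩
    rw [schrodinger_add isOpen_Ioo h3 k3 hx, h4 x hx, k4 x hx, Pi.add_apply]
    ring
  smul_mem' := by
    rintro c ψ ⟨h1, h2, h3, h4⟩
    refine ⟨fun x hx => by simp [h1 x hx], continuousOn_const.smul h2,
      contDiffOn_const.smul h3, fun x hx => ?_⟩
    rw [schrodinger_smul, h4 x hx, Pi.smul_apply, smul_eq_mul]
    ring

/-- The Hermit (Dirichlet) spectrum of `L = -∂ₓ² + 2 ℘(x)` on `[0, T]`: the eigenvalues. -/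
def hermitSpectrum (P : RectPeriods) : Set ℂ :=
  {μ | P.hermitEigenspace μ ≠ ⊥}

/-- `u₀ < u₁ < u₂` are the finite branching points of the spectral curve of
`L = -∂ₓ² + 2 ℘(x)`, i.e. of the curve `℘'² = 4 ℘³ - g₂ ℘ - g₃` as a two-fold covering of the line
of the spectral parameter `u = -℘`. -/
def AreBranchingPoints (P : RectPeriods) (u₀ u₁ u₂ : ℝ) : Prop :=
  u₀ < u₁ ∧ u₁ < u₂ ∧ ∀ u : ℂ,
    4 * (-u) ^ 3 - P.periodPair.g₂ * (-u) - P.periodPair.g₃ =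
      -4 * ((u - u₀) * (u - u₁) * (u - u₂))

end RectPeriods

end

/-!
Write `e₁ > e₂ > e₃` for the values of `℘` at the half-periods `T / 2`, `T / 2 + i ω`, `i ω`; the
branching points are `u₀ = -e₁`, `u₁ = -e₂`, `u₂ = -e₃`. The values are distinct because `℘` takes
each of them only on one class of half-periods, and they are ordered as claimed because `℘` tends to
`+∞` along the real and to `-∞` along the imaginary axis while its critical points are half-periods.

*The regular operator.* Let `θ`, `φ` (`cosSol`, `sinSol`) be the solutions of `L_{iω} f = u f` with
the initial data `(1, 0)` and `(0, 1)` at `0`. The operator `f ↦ F f' - F' f / 2`, with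
`F = ℘(x + i ω) + u`, preserves the solution space. Comparing initial data gives
`F = a θ² + b φ²` with `a = u - u₂`, `b = (u - u₀) (u - u₁)`, and, at `x = T`, that the monodromy
matrix has the form `[[S, a t], [-b t, S]]` with `S² = 1 - a b t²` (`sinSol'_T`, `exists_monodromyCoeff`,
`halfTrace_sq`). Hence the monodromy is scalar exactly where `t = 0`, and the simple
periodic/antiperiodic eigenvalues are the zeros of `a b` with `t ≠ 0`. The Wronskian identity gives
`S' = -t/2 ∫ F` (`hasDerivAt_halfTrace`), and `∫ F ≠ 0` at the branching points since `F` does not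
change sign there; so `S = ±1`, `S' = 0` describes the zeros of `t` as well.

*The zeros of `t`.* At such a zero `φ(T) = 0`, so `u` is a Dirichlet eigenvalue of a self-adjoint
regular problem and is real; as `φ` has no zeros in `(0, T)` for `u = u₂`, where `F` is a multiple
of `φ²`, Sturm comparison gives `u ≥ u₂`, and comparison of the even solutions at `u₁` and `u₂`
excludes `u = u₂` (`exists_real_of_monodromyCoeff_eq_zero`). There are infinitely many, because for
`u > u₂` the phase of `√a θ + i √b φ` advances over a period by `√(a b) ∫ 1 / F`, which is
continuous and unbounded in `u`, and `t = 0` whenever it is a multiple of `π`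
(`monodromyCoeff_eq_zero_of_phase`); they are isolated, by orthogonality of eigenfunctions.

*The singular operator.* Let `χ` be `φ` at `u = u₂`, positive on `(0, T)` and vanishing at `0` and
`T`. Then `(χ' / χ)² = ℘(x) + ℘(x + i ω) + e₃` and `(χ' / χ)' = ℘(x + i ω) - ℘(x)`, so `L` is the
Darboux transform of `L_{iω}` at `χ`. If `ψ` is an eigenfunction of `L`, then `ψ' + (χ' / χ) ψ` is a
solution of the regular equation, and continuity of `ψ` at the ends of the interval forces it to be
a multiple of `φ` with `φ(T) = 0` (`exists_darboux`); conversely `(χ' / χ) φ - φ'` is an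
eigenfunction of `L` when `φ(T) = 0` (`hermitSol_mem`). At `u = u₂` itself there is no eigenfunction
(`hermitEigenspace_e₃`). Therefore the Hermit spectrum is simple and is the zero set of `t`
(`hermitSpectrum_eq`), which yields all assertions.
-/

noncomputable section

/-! ### Linear second order differential equations on the line -/

/-- Uniqueness for `f'' = c f` on an open interval. -/
theorem eq_zero_of_hasDerivAt_mul {𝕜 : Type*} [RCLike 𝕜] {a b x₀ : ℝ} {c f f' : ℝ → 𝕜}
    (hc : ContinuousOn c (Set.Ioo a b)) (hx₀ : x₀ ∈ Set.Ioo a b)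
    (hf : ∀ x ∈ Set.Ioo a b, HasDerivAt f (f' x) x)
    (hf' : ∀ x ∈ Set.Ioo a b, HasDerivAt f' (c x * f x) x)
    (h0 : f x₀ = 0) (h1 : f' x₀ = 0) : ∀ x ∈ Set.Ioo a b, f x = 0 ∧ f' x = 0 := by
  intro x hx
  obtain ⟨a', ha1, ha2⟩ := exists_between (lt_min hx.1 hx₀.1)
  obtain ⟨b', hb1, hb2⟩ := exists_between (max_lt hx.2 hx₀.2)
  rw [lt_min_iff] at ha2
  rw [max_lt_iff] at hb1
  have hsub : Set.Icc a' b' ⊆ Set.Ioo a b := fun t ht =>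
    ⟨ha1.trans_le ht.1, ht.2.trans_lt hb2⟩
  obtain ⟨C, hC⟩ := isCompact_Icc.exists_bound_of_continuousOn (hc.mono hsub)
  have hC0 : 0 ≤ C := (norm_nonneg _).trans (hC x ⟨ha2.1.le, hb1.1.le⟩)
  let v : ℝ → 𝕜 × 𝕜 → 𝕜 × 𝕜 := fun t z => (z.2, c t * z.1)
  have hv : ∀ t ∈ Set.Ioo a' b', LipschitzOnWith (1 + C).toNNReal (v t) Set.univ := by
    intro t ht
    refine (LipschitzWith.of_dist_le_mul fun z z' => ?_).lipschitzOnWith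
    rw [Real.coe_toNNReal _ (by positivity), dist_eq_norm, dist_eq_norm]
    have e : v t z - v t z' = ((z - z').2, c t * (z - z').1) := by
      simp [v, mul_sub]
    rw [e, Prod.norm_def]
    have n1 := norm_fst_le (z - z')
    have n2 := norm_snd_le (z - z')
    have n3 := hC t ⟨ht.1.le, ht.2.le⟩
    refine max_le ?_ ?_
    · simp only
      nlinarith [norm_nonneg (z - z')]
    · simp only [norm_mul]
      nlinarith [norm_nonneg (z - z'), norm_nonneg (c t), norm_nonneg (z - z').1]
  have key := ODE_solution_unique_of_mem_Ioo (f := fun t => (f t, f' t)) (g := fun _ => 0)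
    hv (t₀ := x₀) ⟨ha2.2, hb1.2⟩
    (fun t ht => ⟨(hf t (hsub ⟨ht.1.le, ht.2.le⟩)).prodMk (hf' t (hsub ⟨ht.1.le, ht.2.le⟩)),
      Set.mem_univ _⟩)
    (fun t _ => ⟨by simpa [v, ← Prod.zero_eq_mk] using hasDerivAt_const t (0 : 𝕜 × 𝕜),
      Set.mem_univ _⟩)
    (by simp [h0, h1]) (x := x) ⟨ha2.1, hb1.1⟩
  simpa using key

/-- Uniqueness for `f'' = c f` on the line. -/
theorem eq_of_hasDerivAt_mul {𝕜 : Type*} [RCLike 𝕜] {x₀ : ℝ} {c f f' g g' : ℝ → 𝕜}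
    (hc : Continuous c) (hf : ∀ x, HasDerivAt f (f' x) x)
    (hf' : ∀ x, HasDerivAt f' (c x * f x) x) (hg : ∀ x, HasDerivAt g (g' x) x)
    (hg' : ∀ x, HasDerivAt g' (c x * g x) x)
    (h0 : f x₀ = g x₀) (h1 : f' x₀ = g' x₀) (x : ℝ) : f x = g x ∧ f' x = g' x := by
  have hx : x ∈ Set.Ioo (min x x₀ - 1) (max x x₀ + 1) :=
    ⟨by linarith [min_le_left x x₀], by linarith [le_max_left x x₀]⟩
  have hx₀ : x₀ ∈ Set.Ioo (min x x₀ - 1) (max x x₀ + 1) :=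
    ⟨by linarith [min_le_right x x₀], by linarith [le_max_right x x₀]⟩
  have := eq_zero_of_hasDerivAt_mul (c := c) (f := f - g) (f' := f' - g') hc.continuousOn hx₀
    (fun t _ => (hf t).sub (hg t))
    (fun t _ => by simpa [mul_sub] using (hf' t).sub (hg' t)) (by simp [h0]) (by simp [h1]) x hx
  simpa [sub_eq_zero] using this

open BoundedContinuousFunction in
/-- Existence for the initial value problem of `f'' = (q - u) f`, with solutions jointly continuous
in the variable and the spectral parameter `u`. The solution is `cosh (k x) g` for the fixed point
`g` of a contraction of the bounded continuous functions of `(x, u)`, where the weight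
`cosh (k x)`, `k = k(u)`, makes the integral operator a contraction on the whole line. -/
theorem exists_hasDerivAt_sub_mul {q : ℝ → ℂ} {C : ℝ} (hq : Continuous q)
    (hC : ∀ x, ‖q x‖ ≤ C) (c₀ c₁ : ℂ) :
    ∃ f f' : ℝ × ℂ → ℂ, Continuous f ∧ Continuous f' ∧ ∀ u,
      (∀ x, HasDerivAt (fun s => f (s, u)) (f' (x, u)) x) ∧
      (∀ x, HasDerivAt (fun s => f' (s, u)) ((q x - u) * f (x, u)) x) ∧
      f (0, u) = c₀ ∧ f' (0, u) = c₁ := by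
  have hC0 : 0 ≤ C := (norm_nonneg _).trans (hC 0)
  let κ : ℂ → ℝ := fun u => 1 + C + ‖u‖
  have hκ : ∀ u, 0 < κ u := fun u => by positivity
  have hκc : Continuous κ := by fun_prop
  let w : ℝ × ℂ → ℝ := fun p => Real.cosh (2 * κ p.2 * p.1)
  have hw : ∀ p, 0 < w p := fun p => Real.cosh_pos _
  have hw1 : ∀ p, 1 ≤ w p := fun p => Real.one_le_cosh _
  have hwc : Continuous w := by fun_prop
  let A : ℝ → ℂ → ℂ × ℂ → ℂ × ℂ := fun s u v => (v.2, (q s - u) * v.1)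
  have hA : ∀ s u v, ‖A s u v‖ ≤ κ u * ‖v‖ := by
    intro s u v
    have n1 := norm_fst_le v
    have n2 := norm_snd_le v
    have n3 : ‖q s - u‖ ≤ C + ‖u‖ := (norm_sub_le _ _).trans (by linarith [hC s])
    rw [Prod.norm_def]
    refine max_le ?_ ?_
    · simp only [A, κ]
      nlinarith [norm_nonneg v, norm_nonneg u]
    · simp only [A, κ, norm_mul]
      nlinarith [norm_nonneg v, norm_nonneg u, norm_nonneg v.1, norm_nonneg (q s - u)]
  have hAsub : ∀ s u v v', A s u v - A s u v' = A s u (v - v') := by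
    intro s u v v'
    simp [A, mul_sub]
  -- the integral operator, before division by the weight
  let J : (ℝ × ℂ → ℂ × ℂ) → ℝ × ℂ → ℂ × ℂ := fun g p =>
    ∫ s in (0 : ℝ)..p.1, w (s, p.2) • A s p.2 (g (s, p.2))
  have hAc : ∀ g : ℝ × ℂ → ℂ × ℂ, Continuous g →
      Continuous fun z : (ℝ × ℂ) × ℝ => w (z.2, z.1.2) • A z.2 z.1.2 (g (z.2, z.1.2)) := by
    intro g hg
    simp only [A]
    fun_prop
  have hJc : ∀ g, Continuous g → Continuous (J g) := fun g hg =>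
    intervalIntegral.continuous_parametric_intervalIntegral_of_continuous (hAc g hg)
      continuous_fst
  have hJb : ∀ (g : ℝ × ℂ → ℂ × ℂ) (M : ℝ), 0 ≤ M → (∀ p, ‖g p‖ ≤ M) →
      ∀ p, ‖J g p‖ ≤ M / 2 * w p := by
    intro g M hM hg p
    have hb : ∀ s : ℝ, ‖w (s, p.2) • A s p.2 (g (s, p.2))‖ ≤
        κ p.2 * M * Real.cosh (2 * κ p.2 * s) := by
      intro s
      rw [norm_smul, Real.norm_of_nonneg (hw _).le]
      have h1 := hA s p.2 (g (s, p.2))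
      have h2 : κ p.2 * ‖g (s, p.2)‖ ≤ κ p.2 * M := mul_le_mul_of_nonneg_left (hg _) (hκ _).le
      calc w (s, p.2) * ‖A s p.2 (g (s, p.2))‖ ≤ w (s, p.2) * (κ p.2 * M) :=
            mul_le_mul_of_nonneg_left (h1.trans h2) (hw _).le
        _ = _ := by simp only [w]; ring
    have hder : ∀ x : ℝ, HasDerivAt (fun s => M / 2 * Real.sinh (2 * κ p.2 * s))
        (κ p.2 * M * Real.cosh (2 * κ p.2 * x)) x := by
      intro x
      have := (((hasDerivAt_id x).const_mul (2 * κ p.2)).sinh).const_mul (M / 2)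
      refine this.congr_deriv ?_
      simp only [id]
      ring
    have hcont : Continuous fun s : ℝ => κ p.2 * M * Real.cosh (2 * κ p.2 * s) := by fun_prop
    have h1 := intervalIntegral.norm_integral_le_abs_of_norm_le (a := 0) (b := p.1)
      (μ := MeasureTheory.volume) (f := fun s => w (s, p.2) • A s p.2 (g (s, p.2)))
      (Filter.Eventually.of_forall hb) (hcont.intervalIntegrable _ _)
    rw [intervalIntegral.integral_eq_sub_of_hasDerivAt (fun x _ => hder x)
      (hcont.intervalIntegrable _ _)] at h1
    refine h1.trans ?_
    have h2 : |Real.sinh (2 * κ p.2 * p.1)| ≤ w p := by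
      rw [Real.abs_sinh]
      simp only [w]
      rw [← Real.cosh_abs (2 * κ p.2 * p.1)]
      exact (Real.sinh_lt_cosh _).le
    simp only [mul_zero, Real.sinh_zero, sub_zero, abs_mul]
    rw [abs_of_nonneg (by positivity : (0 : ℝ) ≤ M / 2)]
    gcongr
  have hJsub : ∀ g g' : ℝ × ℂ → ℂ × ℂ, Continuous g → Continuous g' →
      ∀ p, J g p - J g' p = J (g - g') p := by
    intro g g' hg hg' p
    have i1 : ∀ g : ℝ × ℂ → ℂ × ℂ, Continuous g → IntervalIntegrable
        (fun s => w (s, p.2) • A s p.2 (g (s, p.2))) MeasureTheory.volume 0 p.1 := fun g hg =>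
      ((hAc g hg).comp (continuous_const.prodMk continuous_id)).intervalIntegrable
        (μ := MeasureTheory.volume) 0 p.1
    simp only [J]
    rw [← intervalIntegral.integral_sub (i1 g hg) (i1 g' hg')]
    congr 1
    funext s
    rw [← smul_sub, hAsub]
    rfl
  let Y₀ : ℂ × ℂ := (c₀, c₁)
  have hTb : ∀ (g : ℝ × ℂ →ᵇ ℂ × ℂ) p, ‖(w p)⁻¹ • (Y₀ + J g p)‖ ≤ ‖Y₀‖ + ‖g‖ / 2 := by
    intro g p
    rw [norm_smul, norm_inv, Real.norm_of_nonneg (hw p).le, inv_mul_le_iff₀ (hw p)]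
    have h1 := hJb g ‖g‖ (norm_nonneg _) g.norm_coe_le_norm p
    have h2 := norm_add_le Y₀ (J g p)
    nlinarith [hw1 p, norm_nonneg Y₀]
  let T : (ℝ × ℂ →ᵇ ℂ × ℂ) → (ℝ × ℂ →ᵇ ℂ × ℂ) := fun g =>
    BoundedContinuousFunction.ofNormedAddCommGroup (fun p => (w p)⁻¹ • (Y₀ + J g p))
      ((hwc.inv₀ fun p => (hw p).ne').smul (continuous_const.add (hJc g g.continuous)))
      (‖Y₀‖ + ‖g‖ / 2) (hTb g)
  have hT : ContractingWith (1 / 2) T := by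
    refine ⟨by rw [← NNReal.coe_lt_coe]; norm_num, LipschitzWith.of_dist_le_mul fun g g' => ?_⟩
    rw [BoundedContinuousFunction.dist_le (by positivity)]
    intro p
    simp only [T, BoundedContinuousFunction.coe_ofNormedAddCommGroup, dist_eq_norm]
    rw [← smul_sub, add_sub_add_left_eq_sub, hJsub g g' g.continuous g'.continuous, norm_smul,
      norm_inv, Real.norm_of_nonneg (hw p).le, inv_mul_le_iff₀ (hw p)]
    have h1 := hJb (g - g') ‖g - g'‖ (norm_nonneg _) (g - g').norm_coe_le_norm p
    simp only [one_div, NNReal.coe_inv, NNReal.coe_ofNat]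
    linarith
  obtain ⟨g, hg⟩ : ∃ g, T g = g := ⟨_, hT.fixedPoint_isFixedPt⟩
  have hYc : Continuous fun p => w p • g p := hwc.smul g.continuous
  have hY : ∀ p, w p • g p = Y₀ + J g p := by
    intro p
    conv_lhs => rw [← hg]
    simp only [T, BoundedContinuousFunction.coe_ofNormedAddCommGroup]
    rw [smul_inv_smul₀ (hw p).ne']
  have hder : ∀ u x, HasDerivAt (fun s => w (s, u) • g (s, u))
      (A x u (w (x, u) • g (x, u))) x := by
    intro u x
    have e : (fun s => w (s, u) • g (s, u)) = fun s => Y₀ +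
        ∫ t in (0 : ℝ)..s, w (t, u) • A t u (g (t, u)) := by
      funext s
      rw [hY]
    have hc := (hAc g g.continuous).comp
      ((continuous_const (y := ((0 : ℝ), u))).prodMk continuous_id)
    rw [e]
    refine ((intervalIntegral.integral_hasDerivAt_right (hc.intervalIntegrable 0 x)
      (hc.stronglyMeasurableAtFilter _ _) hc.continuousAt).const_add Y₀).congr_deriv ?_
    ext
    · simp [A]
    · simp [A]
      ring
  have h0 : ∀ u, w (0, u) • g (0, u) = Y₀ := fun u => by rw [hY]; simp [J]
  refine ⟨fun p => (w p • g p).1, fun p => (w p • g p).2, continuous_fst.comp hYc,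
    continuous_snd.comp hYc, fun u => ⟨fun x => ?_, fun x => ?_, ?_, ?_⟩⟩
  · exact (hder u x).fst
  · exact (hder u x).snd
  · simp only [h0, Y₀]
  · simp only [h0, Y₀]

/-! ### Injectivity of the Weierstrass function on its critical points -/

namespace PeriodPair

open Filter Topology

variable (L : PeriodPair)

theorem countable_lattice : (L.lattice : Set ℂ).Countable :=
  Set.countable_coe_iff.mp (inferInstanceAs (Countable L.lattice))

theorem isPreconnected_compl_of_countable {s : Set ℂ} (hs : s.Countable) :
    IsPreconnected sᶜ :=
  (hs.isPathConnected_compl_of_one_lt_rank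
    (by rw [Complex.rank_real_complex]; norm_num)).isConnected.isPreconnected

theorem hasDerivAt_weierstrassP {z : ℂ} (hz : z ∉ L.lattice) :
    HasDerivAt L.weierstrassP (L.derivWeierstrassP z) z := by
  rw [← L.deriv_weierstrassP]
  exact (L.analyticOnNhd_weierstrassP z hz).differentiableAt.hasDerivAt

theorem tendsto_weierstrassP_cobounded :
    Tendsto L.weierstrassP (𝓝[≠] 0) (Bornology.cobounded ℂ) := by
  refine tendsto_cobounded_of_meromorphicOrderAt_neg ?_
  rw [L.order_weierstrassP 0 L.lattice.zero_mem]
  decide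

theorem eventually_notMem_lattice {z : ℂ} (hz : z ∉ L.lattice) : ∀ᶠ w in 𝓝 z, w ∉ L.lattice :=
  L.isClosed_lattice.isOpen_compl.mem_nhds hz

theorem eventually_notMem_lattice_zero : ∀ᶠ w in 𝓝[≠] (0 : ℂ), w ∉ L.lattice := by
  filter_upwards [mem_nhdsWithin_of_mem_nhds (L.compl_lattice_sdiff_singleton_mem_nhds 0),
    self_mem_nhdsWithin] with w hw hw0 hwL
  exact hw ⟨hwL, hw0⟩

/-- The second order differential equation of `℘`, obtained by differentiating the first order
one: `℘'` is not identically zero, and analytic functions on a connected set form a domain. -/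
theorem hasDerivAt_derivWeierstrassP {z : ℂ} (hz : z ∉ L.lattice) :
    HasDerivAt L.derivWeierstrassP (6 * L.weierstrassP z ^ 2 - L.g₂ / 2) z := by
  have hU := isPreconnected_compl_of_countable L.countable_lattice
  have hopen : IsOpen (L.lattice : Set ℂ)ᶜ := L.isClosed_lattice.isOpen_compl
  have hP := L.analyticOnNhd_weierstrassP
  have hP' := L.analyticOnNhd_derivWeierstrassP
  have hdiff : ∀ w ∉ L.lattice,
      HasDerivAt L.derivWeierstrassP (deriv L.derivWeierstrassP w) w := fun w hw =>
    (hP' w hw).differentiableAt.hasDerivAt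
  have hg : AnalyticOnNhd ℂ (fun w => deriv L.derivWeierstrassP w -
      (6 * L.weierstrassP w ^ 2 - L.g₂ / 2)) (L.lattice : Set ℂ)ᶜ := by
    intro w hw
    have h1 := hP'.deriv w hw
    have h2 := hP w hw
    fun_prop
  have hmul : ∀ w ∈ (L.lattice : Set ℂ)ᶜ, L.derivWeierstrassP w *
      (deriv L.derivWeierstrassP w - (6 * L.weierstrassP w ^ 2 - L.g₂ / 2)) = 0 := by
    intro w hw
    have h1 := (hdiff w hw).pow 2
    have hd := L.hasDerivAt_weierstrassP hw
    have h2 := (((hd.pow 3).const_mul 4).sub (hd.const_mul L.g₂)).sub_const L.g₃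
    have h3 := h1.unique (h2.congr_of_eventuallyEq (by
      filter_upwards [hopen.mem_nhds hw] with v hv
      simpa using L.derivWeierstrassP_sq v hv))
    simp only [Nat.cast_ofNat] at h3
    linear_combination (1 / 2) * h3
  rcases hP'.eq_zero_or_eq_zero_of_mul_eq_zero hg hmul hU with h | h
  · exfalso
    obtain ⟨c, hc⟩ := hopen.exists_is_const_of_deriv_eq_zero hU L.differentiableOn_weierstrassP
      (fun w hw => by rw [L.deriv_weierstrassP]; exact h w hw)
    refine (L.tendsto_weierstrassP_cobounded.not_tendsto
      (Metric.disjoint_nhds_cobounded c).symm) (tendsto_const_nhds.congr' ?_)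
    filter_upwards [L.eventually_notMem_lattice_zero] with w hw using (hc w hw).symm
  · have := h z hz
    rw [sub_eq_zero] at this
    rw [← this]
    exact hdiff z hz

/-- Two points at which `℘` and `℘'` take the same finite values are congruent modulo the lattice:
by uniqueness for the second order differential equation a translate of `℘` coincides with `℘`, and
so has the same poles. -/
theorem mem_lattice_of_weierstrassP_eq {a d : ℂ} (ha : a ∉ L.lattice) (hd : a + d ∉ L.lattice)
    (h0 : L.weierstrassP (a + d) = L.weierstrassP a)
    (h1 : L.derivWeierstrassP (a + d) = L.derivWeierstrassP a) : d ∈ L.lattice := by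
  by_contra hdL
  set s : Set ℂ := L.lattice ∪ (fun w => w + d) ⁻¹' L.lattice with hs
  have hsc : s.Countable := L.countable_lattice.union
    (L.countable_lattice.preimage (add_left_injective d))
  have hU := isPreconnected_compl_of_countable hsc
  have hf : AnalyticOnNhd ℂ L.weierstrassP sᶜ := fun w hw =>
    L.analyticOnNhd_weierstrassP w fun h => hw (Or.inl h)
  have hg : AnalyticOnNhd ℂ (fun w => L.weierstrassP (w + d)) sᶜ := fun w hw =>
    AnalyticAt.fun_comp (L.analyticOnNhd_weierstrassP (w + d) fun h => hw (Or.inr h))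
      (analyticAt_id.add analyticAt_const)
  have haU : a ∈ sᶜ := by
    rintro (h | h)
    exacts [ha h, hd h]
  have hopen : IsOpen sᶜ := by
    rw [isOpen_compl_iff]
    exact L.isClosed_lattice.union (L.isClosed_lattice.preimage (by fun_prop))
  have hcur : Continuous fun t : ℝ => a + (t : ℂ) := by fun_prop
  obtain ⟨δ, hδ, hball⟩ : ∃ δ > 0, ∀ t ∈ Set.Ioo (-δ) δ, a + ((t : ℝ) : ℂ) ∈ sᶜ := by
    have : (fun t : ℝ => a + (t : ℂ)) ⁻¹' sᶜ ∈ 𝓝 (0 : ℝ) :=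
      hcur.continuousAt.preimage_mem_nhds (hopen.mem_nhds (by simpa using haU))
    obtain ⟨δ, hδ, h⟩ := Metric.mem_nhds_iff.mp this
    refine ⟨δ, hδ, fun t ht => h ?_⟩
    simpa [Real.ball_eq_Ioo] using ht
  have hd1 : ∀ t ∈ Set.Ioo (-δ) δ, HasDerivAt (fun t : ℝ => a + (t : ℂ)) 1 t := fun t _ => by
    simpa using (Complex.ofRealCLM.hasDerivAt (x := t)).const_add a
  have hd2 : ∀ t ∈ Set.Ioo (-δ) δ, HasDerivAt (fun t : ℝ => a + (t : ℂ) + d) 1 t := fun t ht =>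
    (hd1 t ht).add_const d
  have n1 : ∀ t ∈ Set.Ioo (-δ) δ, a + ((t : ℝ) : ℂ) ∉ L.lattice := fun t ht h =>
    hball t ht (Or.inl h)
  have n2 : ∀ t ∈ Set.Ioo (-δ) δ, a + ((t : ℝ) : ℂ) + d ∉ L.lattice := fun t ht h =>
    hball t ht (Or.inr h)
  have hreal := eq_zero_of_hasDerivAt_mul (𝕜 := ℂ) (a := -δ) (b := δ) (x₀ := 0)
    (c := fun t => 6 * (L.weierstrassP (a + t) + L.weierstrassP (a + t + d)))
    (f := fun t => L.weierstrassP (a + t) - L.weierstrassP (a + t + d))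
    (f' := fun t => L.derivWeierstrassP (a + t) - L.derivWeierstrassP (a + t + d))
    (fun t ht => by
      have c1 := (L.hasDerivAt_weierstrassP (n1 t ht)).continuousAt
      have c2 := (L.hasDerivAt_weierstrassP (n2 t ht)).continuousAt
      have c3 : ContinuousAt (fun t : ℝ => L.weierstrassP (a + t)) t :=
        ContinuousAt.comp (f := fun t : ℝ => a + (t : ℂ)) c1 (by fun_prop)
      have c4 : ContinuousAt (fun t : ℝ => L.weierstrassP (a + t + d)) t :=
        ContinuousAt.comp (f := fun t : ℝ => a + (t : ℂ) + d) c2 (by fun_prop)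
      exact (continuousAt_const.mul (c3.add c4)).continuousWithinAt)
    ⟨by linarith, hδ⟩
    (fun t ht => by
      have e1 := (L.hasDerivAt_weierstrassP (n1 t ht)).comp_of_eq t (hd1 t ht) rfl
      have e2 := (L.hasDerivAt_weierstrassP (n2 t ht)).comp_of_eq t (hd2 t ht) rfl
      exact (e1.sub e2).congr_deriv (by ring))
    (fun t ht => by
      have e1 := (L.hasDerivAt_derivWeierstrassP (n1 t ht)).comp_of_eq t (hd1 t ht) rfl
      have e2 := (L.hasDerivAt_derivWeierstrassP (n2 t ht)).comp_of_eq t (hd2 t ht) rfl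
      refine (e1.sub e2).congr_deriv ?_
      ring)
    (by simp [h0]) (by simp [h1])
  have hfreq : ∃ᶠ w in 𝓝[≠] a, L.weierstrassP w = L.weierstrassP (w + d) := by
    have ht : Tendsto (fun t : ℝ => a + (t : ℂ)) (𝓝[≠] 0) (𝓝[≠] a) := by
      refine tendsto_nhdsWithin_iff.mpr ⟨?_, ?_⟩
      · exact (hcur.tendsto' 0 a (by simp)).mono_left nhdsWithin_le_nhds
      · filter_upwards [self_mem_nhdsWithin] with t ht
        simpa using ht
    refine ht.frequently (Eventually.frequently ?_)
    filter_upwards [mem_nhdsWithin_of_mem_nhds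
      (Ioo_mem_nhds (neg_lt_zero.mpr hδ) hδ)] with t ht
    exact sub_eq_zero.mp (hreal t ht).1
  have heq := hf.eqOn_of_preconnected_of_frequently_eq hg hU haU hfreq
  have hlim : Tendsto (fun w => L.weierstrassP (w + d)) (𝓝[≠] 0) (𝓝 (L.weierstrassP d)) := by
    have c : ContinuousAt (fun w => L.weierstrassP (w + d)) 0 :=
      ContinuousAt.comp (f := fun w => w + d) (g := L.weierstrassP) (x := 0)
        (by simpa using (L.hasDerivAt_weierstrassP hdL).continuousAt) (by fun_prop)
    have := c.tendsto.mono_left (nhdsWithin_le_nhds (s := {0}ᶜ))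
    simpa using this
  refine (L.tendsto_weierstrassP_cobounded.not_tendsto
    (Metric.disjoint_nhds_cobounded _).symm) (hlim.congr' ?_)
  have hcd : Tendsto (fun w : ℂ => w + d) (𝓝 0) (𝓝 d) :=
    (continuous_id.add continuous_const).tendsto' 0 d (by simp)
  filter_upwards [L.eventually_notMem_lattice_zero,
    mem_nhdsWithin_of_mem_nhds (hcd.eventually (L.eventually_notMem_lattice hdL))] with w h1 h2
  exact (heq (x := w) (by rintro (h | h); exacts [h1 h, h2 h])).symm

/-- The critical points of `℘` are half-periods. -/
theorem two_mul_mem_lattice_of_derivWeierstrassP_eq_zero {z : ℂ} (hz : z ∉ L.lattice)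
    (h : L.derivWeierstrassP z = 0) : 2 * z ∈ L.lattice := by
  have e : -z + 2 * z = z := by ring
  refine L.mem_lattice_of_weierstrassP_eq (a := -z) (by simpa using hz) (by rwa [e]) ?_ ?_
  · rw [e, L.weierstrassP_neg]
  · rw [e, L.derivWeierstrassP_neg, h, neg_zero]

theorem derivWeierstrassP_eq_zero {z : ℂ} (h : 2 * z ∈ L.lattice) :
    L.derivWeierstrassP z = 0 := by
  have h1 := L.derivWeierstrassP_add_coe (-z) ⟨2 * z, h⟩
  have e : -z + 2 * z = z := by ring
  simp only [e, L.derivWeierstrassP_neg] at h1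
  linear_combination (1 / 2) * h1

theorem tendsto_sq_mul_weierstrassP :
    Tendsto (fun z => z ^ 2 * L.weierstrassP z) (𝓝[≠] 0) (𝓝 1) := by
  have h := L.ite_eq_one_sub_sq_mul_weierstrassP 0 L.lattice.zero_mem
  have hc : ContinuousAt (fun z : ℂ => z ^ 2 * L.weierstrassPExcept 0 z + 1) 0 := by
    have := (L.analyticAt_weierstrassPExcept 0).continuousAt
    fun_prop
  have := hc.tendsto.mono_left (nhdsWithin_le_nhds (s := {0}ᶜ))
  simp only [ne_eq, OfNat.ofNat_ne_zero, not_false_eq_true, zero_pow, zero_mul, zero_add] at this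
  refine this.congr' ?_
  filter_upwards [self_mem_nhdsWithin] with z hz
  have := h z
  rw [if_neg (by simpa using hz)] at this
  simp only [sub_zero] at this
  rw [this]
  simp

end PeriodPair

/-! ### The Weierstrass function of a rectangular lattice on its real and imaginary lines -/

namespace RectPeriods

open Filter Topology ComplexConjugate

variable (P : RectPeriods)

theorem mem_lattice_iff {r s : ℝ} : (r : ℂ) + s * I ∈ P.periodPair.lattice ↔
    ∃ m n : ℤ, r = m * P.T ∧ s = 2 * n * P.ω := by
  rw [PeriodPair.mem_lattice]
  refine exists_congr fun m => exists_congr fun n => ?_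
  simp only [periodPair, Complex.ext_iff]
  simp
  constructor <;> rintro ⟨h1, h2⟩ <;> exact ⟨by linarith, by linarith⟩

theorem ofReal_mem_lattice_iff {r : ℝ} : (r : ℂ) ∈ P.periodPair.lattice ↔
    ∃ m : ℤ, r = m * P.T := by
  have := P.mem_lattice_iff (r := r) (s := 0)
  simp only [ofReal_zero, zero_mul, add_zero] at this
  rw [this]
  exact exists_congr fun m => ⟨fun ⟨n, h, _⟩ => h, fun h => ⟨0, h, by simp⟩⟩

/-- An integer multiple of `p` strictly between `0` and `2 p` is `p`. -/
theorem eq_of_int_mul_mem_Ioo {p x : ℝ} (hp : 0 < p) {m : ℤ} (h : x = m * p) (h0 : 0 < x)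
    (h1 : x < 2 * p) : x = p := by
  subst h
  have m0 : (0 : ℝ) < m := pos_of_mul_pos_left h0 hp.le
  have m1 : (m : ℝ) < 2 := lt_of_mul_lt_mul_right h1 hp.le
  have m0' : 0 < m := by exact_mod_cast m0
  have m1' : m < 2 := by exact_mod_cast m1
  obtain rfl : m = 1 := by omega
  simp

theorem add_omega_notMem (x : ℝ) : (x : ℂ) + P.ω * I ∉ P.periodPair.lattice := by
  rw [mem_lattice_iff]
  rintro ⟨m, n, -, h⟩
  have h2 : (1 : ℝ) = 2 * n := mul_right_cancel₀ P.ω_pos.ne' (by linarith)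
  have : (1 : ℤ) = 2 * n := by exact_mod_cast h2
  omega

theorem ofReal_notMem {x : ℝ} (hx : x ∈ Set.Ioo 0 P.T) : (x : ℂ) ∉ P.periodPair.lattice := by
  rw [ofReal_mem_lattice_iff]
  rintro ⟨m, h⟩
  have := eq_of_int_mul_mem_Ioo P.T_pos h hx.1 (by linarith [hx.2, P.T_pos])
  linarith [hx.2]

theorem mul_I_notMem {s : ℝ} (hs : s ∈ Set.Ioc 0 P.ω) : (s : ℂ) * I ∉ P.periodPair.lattice := by
  have := P.mem_lattice_iff (r := 0) (s := s)
  simp only [ofReal_zero, zero_add] at this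
  rw [this]
  rintro ⟨m, n, -, h⟩
  have := eq_of_int_mul_mem_Ioo (p := 2 * P.ω) (x := s) (m := n) (by linarith [P.ω_pos])
    (by linarith) hs.1 (by linarith [hs.2, P.ω_pos])
  linarith [hs.2, P.ω_pos]

theorem conj_mem_lattice {z : ℂ} (hz : z ∈ P.periodPair.lattice) :
    conj z ∈ P.periodPair.lattice := by
  rw [PeriodPair.mem_lattice] at hz ⊢
  obtain ⟨m, n, rfl⟩ := hz
  exact ⟨m, -n, by simp [periodPair, Complex.conj_ofNat]⟩

/-- Complex conjugation of the lattice. -/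
def conjLattice : P.periodPair.lattice ≃ P.periodPair.lattice where
  toFun l := ⟨conj (l : ℂ), P.conj_mem_lattice l.2⟩
  invFun l := ⟨conj (l : ℂ), P.conj_mem_lattice l.2⟩
  left_inv l := by simp
  right_inv l := by simp

theorem weierstrassP_conj (z : ℂ) :
    P.periodPair.weierstrassP (conj z) = conj (P.periodPair.weierstrassP z) := by
  rw [PeriodPair.weierstrassP, PeriodPair.weierstrassP, Complex.conj_tsum,
    ← P.conjLattice.tsum_eq]
  simp [conjLattice]

theorem derivWeierstrassP_conj (z : ℂ) :
    P.periodPair.derivWeierstrassP (conj z) = conj (P.periodPair.derivWeierstrassP z) := by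
  rw [PeriodPair.derivWeierstrassP, PeriodPair.derivWeierstrassP, map_neg, Complex.conj_tsum,
    ← P.conjLattice.tsum_eq]
  simp [conjLattice, Complex.conj_ofNat]

theorem conj_add_omega (x : ℝ) : conj ((x : ℂ) + P.ω * I) =
    (x + P.ω * I) - (⟨2 * P.ω * I, P.periodPair.ω₂_mem_lattice⟩ : P.periodPair.lattice) := by
  simp
  ring

/-- The Weierstrass function on the line `ℝ + i ω`, where it is real and regular. -/
def wpShift (x : ℝ) : ℝ := (P.periodPair.weierstrassP (x + P.ω * I)).re

/-- The derivative of `wpShift`. -/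
def wpShift' (x : ℝ) : ℝ := (P.periodPair.derivWeierstrassP (x + P.ω * I)).re

/-- The Weierstrass function on the real line, where it is real, with poles in `ℤ T`. -/
def wpReal (x : ℝ) : ℝ := (P.periodPair.weierstrassP x).re

/-- The derivative of `wpReal`. -/
def wpReal' (x : ℝ) : ℝ := (P.periodPair.derivWeierstrassP x).re

theorem weierstrassP_add_omega (x : ℝ) :
    P.periodPair.weierstrassP (x + P.ω * I) = P.wpShift x := by
  refine (Complex.conj_eq_iff_re.mp ?_).symm
  rw [← weierstrassP_conj, conj_add_omega, PeriodPair.weierstrassP_sub_coe]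

theorem derivWeierstrassP_add_omega (x : ℝ) :
    P.periodPair.derivWeierstrassP (x + P.ω * I) = P.wpShift' x := by
  refine (Complex.conj_eq_iff_re.mp ?_).symm
  rw [← derivWeierstrassP_conj, conj_add_omega, PeriodPair.derivWeierstrassP_sub_coe]

theorem weierstrassP_ofReal (x : ℝ) : P.periodPair.weierstrassP x = P.wpReal x := by
  refine (Complex.conj_eq_iff_re.mp ?_).symm
  rw [← weierstrassP_conj, conj_ofReal]

theorem derivWeierstrassP_ofReal (x : ℝ) : P.periodPair.derivWeierstrassP x = P.wpReal' x := by
  refine (Complex.conj_eq_iff_re.mp ?_).symm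
  rw [← derivWeierstrassP_conj, conj_ofReal]

/-- The value of `℘` at the half-period `T / 2`. -/
def e₁ : ℝ := P.wpReal (P.T / 2)

/-- The value of `℘` at the half-period `T / 2 + i ω`. -/
def e₂ : ℝ := P.wpShift (P.T / 2)

/-- The value of `℘` at the half-period `i ω`. -/
def e₃ : ℝ := P.wpShift 0

theorem wpShift_periodic : Function.Periodic P.wpShift P.T := by
  intro x
  have := P.periodPair.weierstrassP_add_coe (x + P.ω * I)
    ⟨P.periodPair.ω₁, P.periodPair.ω₁_mem_lattice⟩
  simp only [wpShift]
  rw [← this]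
  simp only [periodPair, ofReal_add]
  congr 2
  ring

theorem wpShift_neg (x : ℝ) : P.wpShift (-x) = P.wpShift x := by
  simp only [wpShift]
  have e : ((-x : ℝ) : ℂ) + P.ω * I = -conj ((x : ℂ) + P.ω * I) := by
    simp
    ring
  rw [e, PeriodPair.weierstrassP_neg, weierstrassP_conj, conj_re]

theorem cubic_eq_zero_of_critical {z : ℂ} (hz : z ∉ P.periodPair.lattice)
    (h : P.periodPair.derivWeierstrassP z = 0) :
    4 * P.periodPair.weierstrassP z ^ 3 - P.periodPair.g₂ * P.periodPair.weierstrassP z -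
      P.periodPair.g₃ = 0 := by
  rw [← P.periodPair.derivWeierstrassP_sq z hz, h]
  simp

theorem half_mem_Ioo : P.T / 2 ∈ Set.Ioo 0 P.T := ⟨by linarith [P.T_pos], by linarith [P.T_pos]⟩

theorem critical_real : P.periodPair.derivWeierstrassP ((P.T / 2 : ℝ) : ℂ) = 0 := by
  refine P.periodPair.derivWeierstrassP_eq_zero ?_
  have : (2 : ℂ) * ((P.T / 2 : ℝ) : ℂ) = (P.T : ℝ) := by push_cast; ring
  rw [this, ofReal_mem_lattice_iff]
  exact ⟨1, by simp⟩

theorem critical_shift_half :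
    P.periodPair.derivWeierstrassP ((P.T / 2 : ℝ) + P.ω * I) = 0 := by
  refine P.periodPair.derivWeierstrassP_eq_zero ?_
  have : (2 : ℂ) * ((P.T / 2 : ℝ) + P.ω * I) = (P.T : ℝ) + (2 * P.ω : ℝ) * I := by
    push_cast; ring
  rw [this, mem_lattice_iff]
  exact ⟨1, 1, by simp⟩

theorem critical_shift_zero : P.periodPair.derivWeierstrassP ((0 : ℝ) + P.ω * I) = 0 := by
  refine P.periodPair.derivWeierstrassP_eq_zero ?_
  have : (2 : ℂ) * ((0 : ℝ) + P.ω * I) = (0 : ℝ) + (2 * P.ω : ℝ) * I := by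
    push_cast; ring
  rw [this, mem_lattice_iff]
  exact ⟨0, 1, by simp⟩

theorem cubic_e₁ : 4 * (P.e₁ : ℂ) ^ 3 - P.periodPair.g₂ * P.e₁ - P.periodPair.g₃ = 0 := by
  have := P.cubic_eq_zero_of_critical (P.ofReal_notMem P.half_mem_Ioo) P.critical_real
  rwa [weierstrassP_ofReal] at this

theorem cubic_e₂ : 4 * (P.e₂ : ℂ) ^ 3 - P.periodPair.g₂ * P.e₂ - P.periodPair.g₃ = 0 := by
  have := P.cubic_eq_zero_of_critical (P.add_omega_notMem _) P.critical_shift_half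
  rwa [weierstrassP_add_omega] at this

theorem cubic_e₃ : 4 * (P.e₃ : ℂ) ^ 3 - P.periodPair.g₂ * P.e₃ - P.periodPair.g₃ = 0 := by
  have := P.cubic_eq_zero_of_critical (P.add_omega_notMem _) P.critical_shift_zero
  rwa [weierstrassP_add_omega] at this

theorem e₁_ne_e₂ : P.e₁ ≠ P.e₂ := by
  intro h
  have := P.periodPair.mem_lattice_of_weierstrassP_eq (a := ((P.T / 2 : ℝ) : ℂ))
    (d := P.ω * I) (P.ofReal_notMem P.half_mem_Ioo) (P.add_omega_notMem _)
    (by rw [weierstrassP_add_omega, weierstrassP_ofReal]; exact_mod_cast h.symm)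
    (by rw [critical_shift_half, critical_real])
  exact P.add_omega_notMem 0 (by simpa using this)

theorem e₂_ne_e₃ : P.e₂ ≠ P.e₃ := by
  intro h
  have e : ((0 : ℝ) : ℂ) + P.ω * I + (P.T / 2 : ℝ) = ((P.T / 2 : ℝ) + P.ω * I) := by
    push_cast; ring
  have := P.periodPair.mem_lattice_of_weierstrassP_eq (a := ((0 : ℝ) : ℂ) + P.ω * I)
    (d := (P.T / 2 : ℝ)) (P.add_omega_notMem _) (by rw [e]; exact P.add_omega_notMem _)
    (by rw [e, weierstrassP_add_omega, weierstrassP_add_omega]; exact_mod_cast h)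
    (by rw [e, critical_shift_half, critical_shift_zero])
  exact P.ofReal_notMem P.half_mem_Ioo this

theorem e₁_ne_e₃ : P.e₁ ≠ P.e₃ := by
  intro h
  have e : ((0 : ℝ) : ℂ) + P.ω * I + ((P.T / 2 : ℝ) + (-P.ω : ℝ) * I) = (P.T / 2 : ℝ) := by
    push_cast; ring
  have := P.periodPair.mem_lattice_of_weierstrassP_eq (a := ((0 : ℝ) : ℂ) + P.ω * I)
    (d := (P.T / 2 : ℝ) + (-P.ω : ℝ) * I) (P.add_omega_notMem _)
    (by rw [e]; exact P.ofReal_notMem P.half_mem_Ioo)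
    (by rw [e, weierstrassP_add_omega, weierstrassP_ofReal]; exact_mod_cast h)
    (by rw [e, critical_shift_zero, critical_real])
  rw [mem_lattice_iff] at this
  obtain ⟨m, n, h1, -⟩ := this
  have := eq_of_int_mul_mem_Ioo P.T_pos h1 P.half_mem_Ioo.1 (by linarith [P.T_pos])
  linarith [P.T_pos]

/-- The three values are distinct roots of a cubic without quadratic term. -/
theorem e_sum : P.e₁ + P.e₂ + P.e₃ = 0 := by
  have h12 : (P.e₁ : ℂ) - P.e₂ ≠ 0 := by
    rw [sub_ne_zero]; exact_mod_cast P.e₁_ne_e₂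
  have h23 : (P.e₂ : ℂ) - P.e₃ ≠ 0 := by
    rw [sub_ne_zero]; exact_mod_cast P.e₂_ne_e₃
  have h13 : (P.e₁ : ℂ) - P.e₃ ≠ 0 := by
    rw [sub_ne_zero]; exact_mod_cast P.e₁_ne_e₃
  have c1 := P.cubic_e₁
  have c2 := P.cubic_e₂
  have c3 := P.cubic_e₃
  have k : ((P.e₁ : ℂ) - P.e₂) * ((P.e₂ : ℂ) - P.e₃) * ((P.e₁ : ℂ) - P.e₃) *
      (P.e₁ + P.e₂ + P.e₃) = 0 := by
    linear_combination (1 / 4) * ((P.e₂ : ℂ) - P.e₃) * c1 - (1 / 4) * ((P.e₁ : ℂ) - P.e₃) * c2 +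
      (1 / 4) * ((P.e₁ : ℂ) - P.e₂) * c3
  have := (mul_eq_zero.mp k).resolve_left (mul_ne_zero (mul_ne_zero h12 h23) h13)
  exact_mod_cast this

theorem e₂_eq : P.e₂ = -P.e₁ - P.e₃ := by linarith [P.e_sum]

theorem g₂_eq : P.periodPair.g₂ =
    ((-4 * (P.e₁ * P.e₂ + P.e₁ * P.e₃ + P.e₂ * P.e₃) : ℝ) : ℂ) := by
  have h13 : (P.e₁ : ℂ) - P.e₃ ≠ 0 := by
    rw [sub_ne_zero]; exact_mod_cast P.e₁_ne_e₃
  refine mul_left_cancel₀ h13 ?_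
  rw [P.e₂_eq]
  push_cast
  linear_combination P.cubic_e₃ - P.cubic_e₁

theorem g₃_eq : P.periodPair.g₃ = ((4 * P.e₁ * P.e₂ * P.e₃ : ℝ) : ℂ) := by
  have := P.cubic_e₁
  rw [g₂_eq, P.e₂_eq] at this
  rw [P.e₂_eq]
  push_cast at this ⊢
  linear_combination -this

theorem cubic_eq (t : ℂ) : 4 * t ^ 3 - P.periodPair.g₂ * t - P.periodPair.g₃ =
    4 * (t - P.e₁) * (t - P.e₂) * (t - P.e₃) := by
  rw [g₂_eq, g₃_eq, P.e₂_eq]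
  push_cast
  ring

/-! #### The differential equations on the two lines -/

theorem hasDerivAt_wpShift (x : ℝ) : HasDerivAt P.wpShift (P.wpShift' x) x := by
  have h := (P.periodPair.hasDerivAt_weierstrassP (P.add_omega_notMem x)).comp_of_eq x
    ((Complex.ofRealCLM.hasDerivAt (x := x)).add_const (P.ω * I)) rfl
  have := Complex.reCLM.hasFDerivAt.comp_hasDerivAt x h
  simpa [Function.comp_def, wpShift'] using! this

theorem hasDerivAt_wpShift' (x : ℝ) : HasDerivAt P.wpShift'
    (6 * P.wpShift x ^ 2 + 2 * (P.e₁ * P.e₂ + P.e₁ * P.e₃ + P.e₂ * P.e₃)) x := by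
  have h := (P.periodPair.hasDerivAt_derivWeierstrassP (P.add_omega_notMem x)).comp_of_eq x
    ((Complex.ofRealCLM.hasDerivAt (x := x)).add_const (P.ω * I)) rfl
  have := Complex.reCLM.hasFDerivAt.comp_hasDerivAt x h
  refine HasDerivAt.congr_deriv this ?_
  rw [weierstrassP_add_omega, g₂_eq, reCLM_apply, ofRealCLM_apply, ofReal_one, mul_one,
    ← ofReal_re (6 * P.wpShift x ^ 2 + _)]
  congr 1
  push_cast
  ring

theorem wpShift'_sq (x : ℝ) : P.wpShift' x ^ 2 =
    4 * (P.wpShift x - P.e₁) * (P.wpShift x - P.e₂) * (P.wpShift x - P.e₃) := by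
  have := P.periodPair.derivWeierstrassP_sq _ (P.add_omega_notMem x)
  rw [cubic_eq, weierstrassP_add_omega, derivWeierstrassP_add_omega] at this
  exact_mod_cast this

theorem hasDerivAt_wpReal {x : ℝ} (hx : x ∈ Set.Ioo 0 P.T) :
    HasDerivAt P.wpReal (P.wpReal' x) x := by
  have h := (P.periodPair.hasDerivAt_weierstrassP (P.ofReal_notMem hx)).comp_of_eq x
    (Complex.ofRealCLM.hasDerivAt (x := x)) rfl
  have := Complex.reCLM.hasFDerivAt.comp_hasDerivAt x h
  simpa [Function.comp_def, wpReal'] using! this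

theorem hasDerivAt_wpReal' {x : ℝ} (hx : x ∈ Set.Ioo 0 P.T) : HasDerivAt P.wpReal'
    (6 * P.wpReal x ^ 2 + 2 * (P.e₁ * P.e₂ + P.e₁ * P.e₃ + P.e₂ * P.e₃)) x := by
  have h := (P.periodPair.hasDerivAt_derivWeierstrassP (P.ofReal_notMem hx)).comp_of_eq x
    (Complex.ofRealCLM.hasDerivAt (x := x)) rfl
  have := Complex.reCLM.hasFDerivAt.comp_hasDerivAt x h
  refine HasDerivAt.congr_deriv this ?_
  rw [weierstrassP_ofReal, g₂_eq, reCLM_apply, ofRealCLM_apply, ofReal_one, mul_one,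
    ← ofReal_re (6 * P.wpReal x ^ 2 + _)]
  congr 1
  push_cast
  ring

theorem wpReal'_sq {x : ℝ} (hx : x ∈ Set.Ioo 0 P.T) : P.wpReal' x ^ 2 =
    4 * (P.wpReal x - P.e₁) * (P.wpReal x - P.e₂) * (P.wpReal x - P.e₃) := by
  have := P.periodPair.derivWeierstrassP_sq _ (P.ofReal_notMem hx)
  rw [cubic_eq, weierstrassP_ofReal, derivWeierstrassP_ofReal] at this
  exact_mod_cast this

theorem wpShift'_zero : P.wpShift' 0 = 0 := by
  have := P.critical_shift_zero
  rw [derivWeierstrassP_add_omega] at this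
  exact_mod_cast this

theorem wpShift'_half : P.wpShift' (P.T / 2) = 0 := by
  have := P.critical_shift_half
  rw [derivWeierstrassP_add_omega] at this
  exact_mod_cast this

theorem wpReal'_half : P.wpReal' (P.T / 2) = 0 := by
  have := P.critical_real
  rw [derivWeierstrassP_ofReal] at this
  exact_mod_cast this

theorem eq_half_of_wpReal'_eq_zero {x : ℝ} (hx : x ∈ Set.Ioo 0 P.T) (h : P.wpReal' x = 0) :
    x = P.T / 2 := by
  have := P.periodPair.two_mul_mem_lattice_of_derivWeierstrassP_eq_zero (P.ofReal_notMem hx)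
    (by rw [derivWeierstrassP_ofReal, h, ofReal_zero])
  have e : (2 : ℂ) * x = (2 * x : ℝ) := by push_cast; ring
  rw [e, ofReal_mem_lattice_iff] at this
  obtain ⟨m, hm⟩ := this
  linarith [eq_of_int_mul_mem_Ioo P.T_pos hm (by linarith [hx.1]) (by linarith [hx.2])]

theorem eq_half_of_wpShift'_eq_zero {x : ℝ} (hx : x ∈ Set.Ioo 0 P.T) (h : P.wpShift' x = 0) :
    x = P.T / 2 := by
  have := P.periodPair.two_mul_mem_lattice_of_derivWeierstrassP_eq_zero (P.add_omega_notMem x)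
    (by rw [derivWeierstrassP_add_omega, h, ofReal_zero])
  have e : (2 : ℂ) * (x + P.ω * I) = (2 * x : ℝ) + (2 * P.ω : ℝ) * I := by push_cast; ring
  rw [e, mem_lattice_iff] at this
  obtain ⟨m, -, hm, -⟩ := this
  linarith [eq_of_int_mul_mem_Ioo P.T_pos hm (by linarith [hx.1]) (by linarith [hx.2])]

/-! #### The order of the values at the half-periods -/

/-- On the real axis `℘` takes every value above `e₁`, since it tends to `+∞` at `0`. -/
theorem exists_wpReal_eq {c : ℝ} (hc : P.e₁ < c) : ∃ x ∈ Set.Ioo 0 (P.T / 2), P.wpReal x = c := by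
  have ht : Tendsto (fun x : ℝ => (x : ℂ)) (𝓝[>] 0) (𝓝[≠] 0) := by
    refine tendsto_nhdsWithin_iff.mpr ⟨?_, ?_⟩
    · exact (continuous_ofReal.tendsto' 0 0 (by simp)).mono_left nhdsWithin_le_nhds
    · filter_upwards [self_mem_nhdsWithin] with x hx
      simpa using ne_of_gt hx
  have h1 : Tendsto (fun x : ℝ => x ^ 2 * P.wpReal x) (𝓝[>] 0) (𝓝 1) := by
    have := (continuous_re.tendsto 1).comp (P.periodPair.tendsto_sq_mul_weierstrassP.comp ht)
    refine (this.congr fun x => ?_)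
    simp only [Function.comp, weierstrassP_ofReal]
    norm_cast
  have h2 : Tendsto (fun x : ℝ => x ^ 2 * c) (𝓝[>] 0) (𝓝 0) :=
    ((by fun_prop : Continuous fun x : ℝ => x ^ 2 * c).tendsto' 0 0 (by simp)).mono_left
      nhdsWithin_le_nhds
  obtain ⟨x₀, h3, h4, h5⟩ := ((h1.eventually (lt_mem_nhds (by norm_num : (1 / 2 : ℝ) < 1))).and
    ((h2.eventually (gt_mem_nhds (by norm_num : (0 : ℝ) < 1 / 2))).and
      (Ioo_mem_nhdsGT P.half_mem_Ioo.1))).exists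
  have h6 : c < P.wpReal x₀ := lt_of_mul_lt_mul_left (h4.trans h3) (sq_nonneg x₀)
  have hcont : ContinuousOn P.wpReal (Set.Icc x₀ (P.T / 2)) := fun x hx =>
    (P.hasDerivAt_wpReal ⟨h5.1.trans_le hx.1,
      hx.2.trans_lt P.half_mem_Ioo.2⟩).continuousAt.continuousWithinAt
  obtain ⟨x, hx, hxc⟩ := intermediate_value_Icc' h5.2.le hcont ⟨hc.le, h6.le⟩
  refine ⟨x, ⟨h5.1.trans_le hx.1, lt_of_le_of_ne hx.2 ?_⟩, hxc⟩
  rintro rfl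
  exact hc.ne hxc

/-- On the imaginary axis `℘` is real and takes every value below `e₃`. -/
theorem exists_weierstrassP_mul_I_eq {c : ℝ} (hc : c < P.e₃) :
    ∃ s ∈ Set.Ioo 0 P.ω, P.periodPair.weierstrassP (s * I) = c := by
  set f : ℝ → ℝ := fun s => (P.periodPair.weierstrassP (s * I)).re with hf
  have hre : ∀ s : ℝ, P.periodPair.weierstrassP (s * I) = f s := by
    intro s
    refine (Complex.conj_eq_iff_re.mp ?_).symm
    rw [← weierstrassP_conj]
    simp
  have ht : Tendsto (fun s : ℝ => (s : ℂ) * I) (𝓝[>] 0) (𝓝[≠] 0) := by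
    refine tendsto_nhdsWithin_iff.mpr ⟨?_, ?_⟩
    · exact ((by fun_prop : Continuous fun s : ℝ => (s : ℂ) * I).tendsto' 0 0 (by simp)).mono_left
        nhdsWithin_le_nhds
    · filter_upwards [self_mem_nhdsWithin] with x hx
      simpa using ne_of_gt hx
  have h1 : Tendsto (fun s : ℝ => -(s ^ 2 * f s)) (𝓝[>] 0) (𝓝 1) := by
    have := (continuous_re.tendsto 1).comp (P.periodPair.tendsto_sq_mul_weierstrassP.comp ht)
    refine (this.congr fun s => ?_)
    simp only [Function.comp, hre, mul_pow, I_sq]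
    rw [← ofReal_re (-(s ^ 2 * f s))]
    congr 1
    push_cast
    ring
  have h2 : Tendsto (fun x : ℝ => -(x ^ 2 * c)) (𝓝[>] 0) (𝓝 0) :=
    ((by fun_prop : Continuous fun x : ℝ => -(x ^ 2 * c)).tendsto' 0 0 (by simp)).mono_left
      nhdsWithin_le_nhds
  obtain ⟨x₀, h3, h4, h5⟩ := ((h1.eventually (lt_mem_nhds (by norm_num : (1 / 2 : ℝ) < 1))).and
    ((h2.eventually (gt_mem_nhds (by norm_num : (0 : ℝ) < 1 / 2))).and
      (Ioo_mem_nhdsGT P.ω_pos))).exists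
  have h6 : f x₀ < c := lt_of_mul_lt_mul_left (by linarith) (sq_nonneg x₀)
  have hcont : ContinuousOn f (Set.Icc x₀ P.ω) := by
    intro s hs
    have c1 := (P.periodPair.hasDerivAt_weierstrassP
      (P.mul_I_notMem ⟨h5.1.trans_le hs.1, hs.2⟩)).continuousAt
    have c2 : ContinuousAt (fun s : ℝ => P.periodPair.weierstrassP (s * I)) s :=
      ContinuousAt.comp (f := fun s : ℝ => (s : ℂ) * I) c1 (by fun_prop)
    exact (continuous_re.continuousAt.comp c2).continuousWithinAt
  have hend : f P.ω = P.e₃ := by simp [hf, e₃, wpShift]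
  obtain ⟨x, hx, hxc⟩ := intermediate_value_Icc h5.2.le hcont ⟨h6.le, hend ▸ hc.le⟩
  refine ⟨x, ⟨h5.1.trans_le hx.1, lt_of_le_of_ne hx.2 ?_⟩, by rw [hre, hxc]⟩
  rintro rfl
  exact hc.ne (hxc.symm.trans hend)

/-- `℘` takes every value above `e₁` on `(0, T / 2)`. At a root of the cubic its derivative would
vanish there, but all critical points are half-periods. -/
theorem le_e₁_of_root {c : ℝ} (h : (c - P.e₁) * (c - P.e₂) * (c - P.e₃) = 0) : c ≤ P.e₁ := by
  by_contra! hc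
  obtain ⟨x, hx, hxc⟩ := P.exists_wpReal_eq hc
  have hx' : x ∈ Set.Ioo 0 P.T := ⟨hx.1, hx.2.trans P.half_mem_Ioo.2⟩
  have h1 := P.wpReal'_sq hx'
  rw [hxc] at h1
  have h2 := P.eq_half_of_wpReal'_eq_zero hx' (pow_eq_zero_iff two_ne_zero |>.mp (by
    linear_combination h1 + 4 * h))
  exact hx.2.ne h2

theorem e₂_lt_e₁ : P.e₂ < P.e₁ := (P.le_e₁_of_root (by ring)).lt_of_ne P.e₁_ne_e₂.symm

/-- Otherwise `℘` would take the value `e₂` on the imaginary axis strictly between `0` and `i ω`,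
where it has no critical points. -/
theorem e₃_lt_e₂ : P.e₃ < P.e₂ := by
  refine lt_of_le_of_ne ?_ P.e₂_ne_e₃.symm
  by_contra! hc
  obtain ⟨s, hs, hsc⟩ := P.exists_weierstrassP_mul_I_eq hc
  have hs' := P.mul_I_notMem ⟨hs.1, hs.2.le⟩
  have h1 := P.periodPair.derivWeierstrassP_sq _ hs'
  rw [cubic_eq, hsc] at h1
  have h2 := P.periodPair.two_mul_mem_lattice_of_derivWeierstrassP_eq_zero hs'
    (pow_eq_zero_iff two_ne_zero |>.mp (by linear_combination h1))
  have e : (2 : ℂ) * (s * I) = (0 : ℝ) + (2 * s : ℝ) * I := by push_cast; ring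
  rw [e, mem_lattice_iff] at h2
  obtain ⟨-, n, -, hn⟩ := h2
  have := eq_of_int_mul_mem_Ioo (m := n) P.ω_pos (by linarith : s = n * P.ω) hs.1
    (by linarith [hs.2, P.ω_pos])
  exact hs.2.ne this

theorem continuous_wpShift : Continuous P.wpShift :=
  continuous_iff_continuousAt.mpr fun x => (P.hasDerivAt_wpShift x).continuousAt

theorem continuousOn_wpReal : ContinuousOn P.wpReal (Set.Ioo 0 P.T) := fun _ hx =>
  (P.hasDerivAt_wpReal hx).continuousAt.continuousWithinAt

/-- A continuous function on an interval that omits the value `c` stays on one side of `c`. -/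
theorem lt_of_continuousOn_of_ne {f : ℝ → ℝ} {s : Set ℝ} (hs : s.OrdConnected)
    (hf : ContinuousOn f s) {c x₀ : ℝ} (hx₀ : x₀ ∈ s) (h₀ : c < f x₀) (hne : ∀ x ∈ s, f x ≠ c)
    {x : ℝ} (hx : x ∈ s) : c < f x := by
  by_contra! h
  obtain ⟨z, hz, hzc⟩ := hs.isPreconnected.intermediate_value hx hx₀ hf ⟨h, h₀.le⟩
  exact hne z hz hzc

theorem e₃_lt_wpShift {x : ℝ} (hx : x ∈ Set.Ioo 0 P.T) : P.e₃ < P.wpShift x := by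
  refine lt_of_continuousOn_of_ne Set.ordConnected_Ioo P.continuous_wpShift.continuousOn
    P.half_mem_Ioo P.e₃_lt_e₂ (fun z hz h => ?_) hx
  have h1 := P.wpShift'_sq z
  rw [h, sub_self, mul_zero] at h1
  have := P.eq_half_of_wpShift'_eq_zero hz (pow_eq_zero_iff two_ne_zero |>.mp h1)
  subst this
  exact P.e₂_ne_e₃ h

theorem wpShift_lt_e₂ {x : ℝ} (hx : x ∈ Set.Ico 0 (P.T / 2)) : P.wpShift x < P.e₂ := by
  have := lt_of_continuousOn_of_ne (f := fun x => -P.wpShift x) (s := Set.Ico 0 (P.T / 2))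
    Set.ordConnected_Ico P.continuous_wpShift.neg.continuousOn (c := -P.e₂)
    (x₀ := 0) ⟨le_rfl, P.half_mem_Ioo.1⟩ (neg_lt_neg P.e₃_lt_e₂) (fun z hz h => ?_) hx
  · simpa using this
  have h : P.wpShift z = P.e₂ := neg_injective h
  rcases hz.1.eq_or_lt with rfl | hz0
  · exact P.e₂_ne_e₃ h.symm
  have h1 := P.wpShift'_sq z
  rw [h, sub_self, mul_zero, zero_mul] at h1
  have := P.eq_half_of_wpShift'_eq_zero ⟨hz0, hz.2.trans P.half_mem_Ioo.2⟩
    (pow_eq_zero_iff two_ne_zero |>.mp h1)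
  exact hz.2.ne this

theorem e₃_lt_wpReal {x : ℝ} (hx : x ∈ Set.Ioo 0 P.T) : P.e₃ < P.wpReal x := by
  refine lt_of_continuousOn_of_ne Set.ordConnected_Ioo P.continuousOn_wpReal
    P.half_mem_Ioo (P.e₃_lt_e₂.trans P.e₂_lt_e₁) (fun z hz h => ?_) hx
  have h1 := P.wpReal'_sq hz
  rw [h, sub_self, mul_zero] at h1
  have := P.eq_half_of_wpReal'_eq_zero hz (pow_eq_zero_iff two_ne_zero |>.mp h1)
  subst this
  exact P.e₁_ne_e₃ h

theorem wpShift_T : P.wpShift P.T = P.e₃ := by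
  simpa [e₃] using P.wpShift_periodic 0

theorem wpShift'_T : P.wpShift' P.T = 0 := by
  have h1 := P.hasDerivAt_wpShift 0
  have h2 := (P.hasDerivAt_wpShift (0 + P.T)).comp_add_const 0 P.T
  rw [show (fun x => P.wpShift (x + P.T)) = P.wpShift from funext P.wpShift_periodic,
    zero_add] at h2
  rw [h2.unique h1, wpShift'_zero]

theorem wpShift_sub (x : ℝ) : P.wpShift (P.T - x) = P.wpShift x := by
  rw [← wpShift_neg, neg_sub, P.wpShift_periodic.sub_eq]

theorem wpShift_mem_Icc {x : ℝ} (hx : x ∈ Set.Icc 0 P.T) :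
    P.wpShift x ∈ Set.Icc P.e₃ P.e₂ := by
  refine ⟨?_, ?_⟩
  · rcases hx.1.eq_or_lt with rfl | h0
    · exact le_rfl
    rcases hx.2.eq_or_lt with rfl | h1
    · exact P.wpShift_T.ge
    exact (P.e₃_lt_wpShift ⟨h0, h1⟩).le
  · rcases lt_trichotomy x (P.T / 2) with h | rfl | h
    · exact (P.wpShift_lt_e₂ ⟨hx.1, h⟩).le
    · exact le_rfl
    · rw [← wpShift_sub]
      exact (P.wpShift_lt_e₂ ⟨by linarith [hx.2], by linarith⟩).le

theorem wpShift_mem_Icc' (x : ℝ) : P.wpShift x ∈ Set.Icc P.e₃ P.e₂ := by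
  obtain ⟨z, hz, h⟩ := P.wpShift_periodic.exists_mem_Ico₀ P.T_pos x
  rw [h]
  exact P.wpShift_mem_Icc ⟨hz.1, hz.2.le⟩

/-- Translation of `℘` by the half-period `i ω`: both sides of
`℘(x + i ω) = e₃ + (e₃ - e₁) (e₃ - e₂) / (℘(x) - e₃)` solve the same second order equation with
the same initial data at `T / 2`. -/
theorem wpShift_sub_mul_wpReal_sub {x : ℝ} (hx : x ∈ Set.Ioo 0 P.T) :
    (P.wpShift x - P.e₃) * (P.wpReal x - P.e₃) = (P.e₃ - P.e₁) * (P.e₃ - P.e₂) := by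
  set b := (P.e₃ - P.e₁) * (P.e₃ - P.e₂) with hb
  have hpos : ∀ z ∈ Set.Ioo 0 P.T, P.wpReal z - P.e₃ ≠ 0 := fun z hz =>
    (sub_pos.mpr (P.e₃_lt_wpReal hz)).ne'
  have key := eq_zero_of_hasDerivAt_mul (𝕜 := ℝ) (a := 0) (b := P.T) (x₀ := P.T / 2)
    (c := fun z => 6 * (P.wpShift z + (P.e₃ + b / (P.wpReal z - P.e₃))))
    (f := fun z => P.wpShift z - (P.e₃ + b / (P.wpReal z - P.e₃)))
    (f' := fun z => P.wpShift' z + b * P.wpReal' z / (P.wpReal z - P.e₃) ^ 2)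
    ?_ P.half_mem_Ioo ?_ ?_ ?_ ?_ x hx
  · have h1 := key.1
    have h2 := hpos x hx
    field_simp at h1
    linear_combination h1
  · have h1 := P.continuous_wpShift.continuousOn (s := Set.Ioo 0 P.T)
    have h2 := P.continuousOn_wpReal
    exact continuousOn_const.mul (h1.add (continuousOn_const.add
      (continuousOn_const.div (h2.sub continuousOn_const) hpos)))
  · intro z hz
    have h1 := (P.hasDerivAt_wpReal hz).sub_const P.e₃
    have h2 := (P.hasDerivAt_wpShift z).sub (((h1.inv (hpos z hz)).const_mul b).const_add P.e₃)
    refine (h2.congr_deriv (by ring)).congr_of_eventuallyEq ?_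
    exact Filter.Eventually.of_forall fun z => by simp [div_eq_mul_inv]
  · intro z hz
    have h1 := (P.hasDerivAt_wpReal hz).sub_const P.e₃
    have h2 := (P.hasDerivAt_wpReal' hz).const_mul b
    have h3 := (P.hasDerivAt_wpShift' z).add (h2.div (h1.pow 2) (pow_ne_zero 2 (hpos z hz)))
    refine h3.congr_deriv ?_
    have h4 := P.wpReal'_sq hz
    have h5 := hpos z hz
    have h6 := P.e₂_eq
    simp only [Nat.cast_ofNat, Nat.add_one_sub_one, pow_one, Pi.pow_apply]
    have h7 : b * P.wpReal' z * (2 * (P.wpReal z - P.e₃) * P.wpReal' z) =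
        2 * b * (P.wpReal z - P.e₃) *
          (4 * (P.wpReal z - P.e₁) * (P.wpReal z - P.e₂) * (P.wpReal z - P.e₃)) := by
      rw [← h4]; ring
    rw [h7]
    field_simp
    rw [hb, h6]
    ring
  · have h1 := P.e₁_ne_e₃
    rw [← sub_ne_zero] at h1
    change P.e₂ - (P.e₃ + b / (P.e₁ - P.e₃)) = 0
    rw [hb]
    field_simp
    ring
  · simp only [wpShift'_half, wpReal'_half]
    simp

/-! ### Solutions of the regular Lamé equation -/

theorem lamePotential_shift (x : ℝ) : P.lamePotential (P.ω * I) x = 2 * P.wpShift x := by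
  rw [lamePotential, weierstrassP_add_omega]

/-- The pair `(f, f')` is a solution, with its derivative, of the regular Lamé equation
`L_{iω} f = u f`. -/
def IsLameSolution (u : ℂ) (f f' : ℝ → ℂ) : Prop :=
  (∀ x, HasDerivAt f (f' x) x) ∧ ∀ x, HasDerivAt f' ((2 * P.wpShift x - u) * f x) x

theorem continuous_coeff (u : ℂ) : Continuous fun x => 2 * (P.wpShift x : ℂ) - u := by
  have := P.continuous_wpShift
  fun_prop

namespace IsLameSolution

variable {P} {u v : ℂ} {f f' g g' : ℝ → ℂ}

theorem eq_of_initial (hf : P.IsLameSolution u f f') (hg : P.IsLameSolution u g g') (x₀ : ℝ)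
    (h0 : f x₀ = g x₀) (h1 : f' x₀ = g' x₀) (x : ℝ) : f x = g x ∧ f' x = g' x :=
  eq_of_hasDerivAt_mul (P.continuous_coeff u) hf.1 hf.2 hg.1 hg.2 h0 h1 x

theorem continuous (hf : P.IsLameSolution u f f') : Continuous f :=
  continuous_iff_continuousAt.mpr fun x => (hf.1 x).continuousAt

theorem continuous' (hf : P.IsLameSolution u f f') : Continuous f' :=
  continuous_iff_continuousAt.mpr fun x => (hf.2 x).continuousAt

theorem deriv_eq (hf : P.IsLameSolution u f f') : deriv f = f' := funext fun x => (hf.1 x).deriv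

theorem lin (hf : P.IsLameSolution u f f') (hg : P.IsLameSolution u g g') (α β : ℂ) :
    P.IsLameSolution u (fun x => α * f x + β * g x) (fun x => α * f' x + β * g' x) := by
  refine ⟨fun x => ((hf.1 x).const_mul α).add ((hg.1 x).const_mul β), fun x => ?_⟩
  exact (((hf.2 x).const_mul α).add ((hg.2 x).const_mul β)).congr_deriv (by ring)

theorem translate (hf : P.IsLameSolution u f f') :
    P.IsLameSolution u (fun x => f (x + P.T)) (fun x => f' (x + P.T)) := by
  refine ⟨fun x => (hf.1 (x + P.T)).comp_add_const x P.T, fun x => ?_⟩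
  have := (hf.2 (x + P.T)).comp_add_const x P.T
  rwa [P.wpShift_periodic] at this

theorem reflect (hf : P.IsLameSolution u f f') :
    P.IsLameSolution u (fun x => f (-x)) (fun x => -f' (-x)) := by
  refine ⟨fun x => ?_, fun x => ?_⟩
  · have := (hf.1 (-x)).scomp x (hasDerivAt_neg x)
    simpa using! this
  · have := ((hf.2 (-x)).scomp x (hasDerivAt_neg x)).neg
    rw [P.wpShift_neg] at this
    simpa using! this

theorem conjugate (hf : P.IsLameSolution u f f') :
    P.IsLameSolution (conj u) (fun x => conj (f x)) (fun x => conj (f' x)) := by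
  refine ⟨fun x => (hf.1 x).star, fun x => (hf.2 x).star.congr_deriv ?_⟩
  simp

/-- The Wronskian identity for solutions at two values of the spectral parameter. -/
theorem hasDerivAt_wronskian (hf : P.IsLameSolution u f f') (hg : P.IsLameSolution v g g')
    (x : ℝ) : HasDerivAt (fun x => f x * g' x - f' x * g x) ((u - v) * (f x * g x)) x :=
  (((hf.1 x).mul (hg.2 x)).sub ((hf.2 x).mul (hg.1 x))).congr_deriv (by ring)

theorem mul_integral (hf : P.IsLameSolution u f f') (hg : P.IsLameSolution v g g')
    (a b : ℝ) : (u - v) * ∫ x in a..b, f x * g x =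
      f b * g' b - f' b * g b - (f a * g' a - f' a * g a) := by
  rw [← intervalIntegral.integral_const_mul]
  refine intervalIntegral.integral_eq_sub_of_hasDerivAt
    (fun x _ => hf.hasDerivAt_wronskian hg x) ?_
  exact (continuous_const.mul (hf.continuous.mul hg.continuous)).intervalIntegrable _ _

end IsLameSolution

theorem exists_isLameSolution (c₀ c₁ : ℂ) :
    ∃ f f' : ℝ × ℂ → ℂ, Continuous f ∧ Continuous f' ∧ ∀ u,
      (∀ x, HasDerivAt (fun s => f (s, u)) (f' (x, u)) x) ∧
      (∀ x, HasDerivAt (fun s => f' (s, u)) ((2 * P.wpShift x - u) * f (x, u)) x) ∧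
      f (0, u) = c₀ ∧ f' (0, u) = c₁ := by
  refine exists_hasDerivAt_sub_mul (q := fun x => 2 * P.wpShift x)
    (C := 2 * max |P.e₃| |P.e₂|) (by have := P.continuous_wpShift; fun_prop) (fun x => ?_) c₀ c₁
  have h := P.wpShift_mem_Icc' x
  rw [norm_mul, Complex.norm_real, Complex.norm_ofNat, Real.norm_eq_abs]
  exact mul_le_mul_of_nonneg_left (abs_le_max_abs_abs h.1 h.2) (by norm_num)

/-- The solution of `L_{iω} θ = u θ` with `θ(0) = 1`, `θ'(0) = 0`. -/
def cosSol (u : ℂ) (x : ℝ) : ℂ := (P.exists_isLameSolution 1 0).choose (x, u)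

/-- The derivative of `cosSol` in the variable. -/
def cosSol' (u : ℂ) (x : ℝ) : ℂ := (P.exists_isLameSolution 1 0).choose_spec.choose (x, u)

/-- The solution of `L_{iω} φ = u φ` with `φ(0) = 0`, `φ'(0) = 1`. -/
def sinSol (u : ℂ) (x : ℝ) : ℂ := (P.exists_isLameSolution 0 1).choose (x, u)

/-- The derivative of `sinSol` in the variable. -/
def sinSol' (u : ℂ) (x : ℝ) : ℂ := (P.exists_isLameSolution 0 1).choose_spec.choose (x, u)

theorem continuous_cosSol : Continuous fun p : ℂ × ℝ => P.cosSol p.1 p.2 :=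
  (P.exists_isLameSolution 1 0).choose_spec.choose_spec.1.comp continuous_swap

theorem continuous_sinSol : Continuous fun p : ℂ × ℝ => P.sinSol p.1 p.2 :=
  (P.exists_isLameSolution 0 1).choose_spec.choose_spec.1.comp continuous_swap

theorem isLameSolution_cosSol (u : ℂ) : P.IsLameSolution u (P.cosSol u) (P.cosSol' u) :=
  have h := (P.exists_isLameSolution 1 0).choose_spec.choose_spec.2.2 u
  ⟨h.1, h.2.1⟩

theorem isLameSolution_sinSol (u : ℂ) : P.IsLameSolution u (P.sinSol u) (P.sinSol' u) :=
  have h := (P.exists_isLameSolution 0 1).choose_spec.choose_spec.2.2 u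
  ⟨h.1, h.2.1⟩

@[simp] theorem cosSol_zero (u : ℂ) : P.cosSol u 0 = 1 :=
  ((P.exists_isLameSolution 1 0).choose_spec.choose_spec.2.2 u).2.2.1

@[simp] theorem cosSol'_zero (u : ℂ) : P.cosSol' u 0 = 0 :=
  ((P.exists_isLameSolution 1 0).choose_spec.choose_spec.2.2 u).2.2.2

@[simp] theorem sinSol_zero (u : ℂ) : P.sinSol u 0 = 0 :=
  ((P.exists_isLameSolution 0 1).choose_spec.choose_spec.2.2 u).2.2.1

@[simp] theorem sinSol'_zero (u : ℂ) : P.sinSol' u 0 = 1 :=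
  ((P.exists_isLameSolution 0 1).choose_spec.choose_spec.2.2 u).2.2.2

theorem wronskian_eq_one (u : ℂ) (x : ℝ) :
    P.cosSol u x * P.sinSol' u x - P.cosSol' u x * P.sinSol u x = 1 := by
  have := (P.isLameSolution_cosSol u).mul_integral (P.isLameSolution_sinSol u) 0 x
  simp only [sub_self, zero_mul, cosSol_zero, sinSol'_zero, cosSol'_zero, sinSol_zero] at this
  linear_combination -this

variable {P} in
theorem IsLameSolution.eq_lin {u : ℂ} {f f' : ℝ → ℂ} (hf : P.IsLameSolution u f f') (x : ℝ) :
    f x = f 0 * P.cosSol u x + f' 0 * P.sinSol u x ∧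
      f' x = f 0 * P.cosSol' u x + f' 0 * P.sinSol' u x :=
  hf.eq_of_initial ((P.isLameSolution_cosSol u).lin (P.isLameSolution_sinSol u) (f 0) (f' 0)) 0
    (by simp) (by simp) x

theorem cosSol_neg (u : ℂ) (x : ℝ) : P.cosSol u (-x) = P.cosSol u x :=
  ((P.isLameSolution_cosSol u).reflect.eq_of_initial (P.isLameSolution_cosSol u) 0
    (by simp) (by simp) x).1

theorem sinSol_neg (u : ℂ) (x : ℝ) : P.sinSol u (-x) = -P.sinSol u x := by
  have := ((P.isLameSolution_sinSol u).reflect.eq_lin x).1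
  simpa using this

/-! ### The solution space and the monodromy matrix -/

theorem mem_solutionSpace_iff {u : ℂ} {ψ : ℝ → ℂ} :
    ψ ∈ solutionSpace (P.lamePotential (P.ω * I)) u ↔ P.IsLameSolution u ψ (deriv ψ) := by
  constructor
  · rintro ⟨h1, h2⟩
    have hd : ContDiff ℝ 1 (deriv ψ) := by
      have : ContDiff ℝ (1 + 1) ψ := by simpa [one_add_one_eq_two] using h1
      exact (contDiff_succ_iff_deriv.mp this).2.2
    refine ⟨fun x => (h1.differentiable (by norm_num) x).hasDerivAt, fun x => ?_⟩
    refine (hd.differentiable (by norm_num) x).hasDerivAt.congr_deriv ?_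
    have := h2 x
    rw [schrodinger, lamePotential_shift] at this
    linear_combination -this
  · intro h
    have hd2 : deriv (deriv ψ) = fun x => (2 * P.wpShift x - u) * ψ x :=
      funext fun x => (h.2 x).deriv
    refine ⟨?_, fun x => ?_⟩
    · rw [show (2 : WithTop ℕ∞) = 1 + 1 from one_add_one_eq_two.symm, contDiff_succ_iff_deriv]
      refine ⟨fun x => (h.1 x).differentiableAt, by simp, ?_⟩
      rw [contDiff_one_iff_deriv]
      refine ⟨fun x => (h.2 x).differentiableAt, ?_⟩
      rw [hd2]
      exact (P.continuous_coeff u).mul h.continuous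
    · rw [schrodinger, lamePotential_shift, hd2]
      ring

variable {P} in
theorem IsLameSolution.mem_solutionSpace {u : ℂ} {f f' : ℝ → ℂ} (h : P.IsLameSolution u f f') :
    f ∈ solutionSpace (P.lamePotential (P.ω * I)) u := by
  rw [mem_solutionSpace_iff, h.deriv_eq]
  exact h

/-- The solution with given initial data at `0`. -/
def solOfInitial (u : ℂ) : (Fin 2 → ℂ) →ₗ[ℂ] solutionSpace (P.lamePotential (P.ω * I)) u where
  toFun c := ⟨fun x => c 0 * P.cosSol u x + c 1 * P.sinSol u x,
    ((P.isLameSolution_cosSol u).lin (P.isLameSolution_sinSol u) _ _).mem_solutionSpace⟩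
  map_add' c d := by
    ext x
    simp
    ring
  map_smul' r c := by
    ext x
    simp
    ring

theorem solOfInitial_bijective (u : ℂ) : Function.Bijective (P.solOfInitial u) := by
  constructor
  · rw [injective_iff_map_eq_zero]
    intro c hc
    have h1 : ∀ x, c 0 * P.cosSol u x + c 1 * P.sinSol u x = 0 := fun x =>
      congrFun (congrArg Subtype.val hc) x
    have h2 := ((P.isLameSolution_cosSol u).lin (P.isLameSolution_sinSol u) (c 0) (c 1)).deriv_eq
    have h3 := congrFun h2 0
    rw [show (fun x => c 0 * P.cosSol u x + c 1 * P.sinSol u x) = fun _ => 0 from funext h1] at h3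
    have h0 := h1 0
    simp at h0 h3
    ext i
    fin_cases i
    · exact h0
    · exact h3.symm
  · rintro ⟨ψ, hψ⟩
    refine ⟨![ψ 0, deriv ψ 0], Subtype.ext (funext fun x => ?_)⟩
    exact (((P.mem_solutionSpace_iff).mp hψ).eq_lin x).1.symm

/-- Solutions correspond to their initial data at `0`. -/
def solEquiv (u : ℂ) : (Fin 2 → ℂ) ≃ₗ[ℂ] solutionSpace (P.lamePotential (P.ω * I)) u :=
  LinearEquiv.ofBijective (P.solOfInitial u) (P.solOfInitial_bijective u)

/-- The matrix of the monodromy operator in the basis `cosSol`, `sinSol`. -/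
def monodromyMatrix (u : ℂ) : Matrix (Fin 2) (Fin 2) ℂ :=
  !![P.cosSol u P.T, P.sinSol u P.T; P.cosSol' u P.T, P.sinSol' u P.T]

theorem shiftedMonodromy_eq (u : ℂ) :
    P.shiftedMonodromy u = (P.solEquiv u).conj (Matrix.toLin' (P.monodromyMatrix u)) := by
  refine LinearMap.ext fun ψ => ?_
  obtain ⟨c, rfl⟩ := (P.solEquiv u).surjective ψ
  rw [LinearEquiv.conj_apply_apply, LinearEquiv.symm_apply_apply]
  refine Subtype.ext (funext fun x => ?_)
  change c 0 * P.cosSol u (x + P.T) + c 1 * P.sinSol u (x + P.T) =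
    (Matrix.toLin' (P.monodromyMatrix u) c) 0 * P.cosSol u x +
      (Matrix.toLin' (P.monodromyMatrix u) c) 1 * P.sinSol u x
  have := (((P.isLameSolution_cosSol u).lin (P.isLameSolution_sinSol u)
    (c 0) (c 1)).translate.eq_lin x).1
  simp only [zero_add] at this
  rw [this]
  simp [monodromyMatrix, Matrix.toLin'_apply, Matrix.mulVec, dotProduct, Fin.sum_univ_two]
  ring

theorem finrank_solutionSpace (u : ℂ) :
    Module.finrank ℂ (solutionSpace (P.lamePotential (P.ω * I)) u) = 2 := by
  rw [← (P.solEquiv u).finrank_eq]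
  simp

instance finiteDimensional_solutionSpace (u : ℂ) :
    FiniteDimensional ℂ (solutionSpace (P.lamePotential (P.ω * I)) u) :=
  (P.solEquiv u).finiteDimensional

theorem halfTrace_eq (u : ℂ) : P.halfTrace u = (P.cosSol u P.T + P.sinSol' u P.T) / 2 := by
  rw [halfTrace, shiftedMonodromy_eq, LinearMap.trace_conj', Matrix.trace_toLin'_eq]
  simp [monodromyMatrix, Matrix.trace, Fin.sum_univ_two]

theorem solEquiv_mem_eigenspace_iff {u ε : ℂ} {c : Fin 2 → ℂ} :
    P.solEquiv u c ∈ (P.shiftedMonodromy u).eigenspace ε ↔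
      c 0 * P.cosSol u P.T + c 1 * P.sinSol u P.T = ε * c 0 ∧
      c 0 * P.cosSol' u P.T + c 1 * P.sinSol' u P.T = ε * c 1 := by
  rw [Module.End.mem_eigenspace_iff, shiftedMonodromy_eq, LinearEquiv.conj_apply_apply,
    LinearEquiv.symm_apply_apply, ← map_smul, (P.solEquiv u).injective.eq_iff, funext_iff,
    Fin.forall_fin_two]
  simp [monodromyMatrix, Matrix.toLin'_apply, Matrix.mulVec, dotProduct, Fin.sum_univ_two,
    mul_comm]

theorem eigenspace_eq_top_iff {u ε : ℂ} : (P.shiftedMonodromy u).eigenspace ε = ⊤ ↔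
    P.cosSol u P.T = ε ∧ P.sinSol u P.T = 0 ∧ P.cosSol' u P.T = 0 ∧ P.sinSol' u P.T = ε := by
  constructor
  · intro h
    have h1 := P.solEquiv_mem_eigenspace_iff (u := u) (ε := ε) (c := ![1, 0])
    have h2 := P.solEquiv_mem_eigenspace_iff (u := u) (ε := ε) (c := ![0, 1])
    simp only [h, Submodule.mem_top, true_iff] at h1 h2
    simp at h1 h2
    exact ⟨h1.1, h2.1, h1.2, h2.2⟩
  · rintro ⟨h1, h2, h3, h4⟩
    refine eq_top_iff.mpr fun ψ _ => ?_
    obtain ⟨c, rfl⟩ := (P.solEquiv u).surjective ψ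
    rw [solEquiv_mem_eigenspace_iff, h1, h2, h3, h4]
    constructor <;> ring

theorem eigenspace_ne_bot_iff {u ε : ℂ} : (P.shiftedMonodromy u).eigenspace ε ≠ ⊥ ↔
    ∃ α β : ℂ, (α ≠ 0 ∨ β ≠ 0) ∧ α * P.cosSol u P.T + β * P.sinSol u P.T = ε * α ∧
      α * P.cosSol' u P.T + β * P.sinSol' u P.T = ε * β := by
  rw [Submodule.ne_bot_iff]
  constructor
  · rintro ⟨ψ, h1, h2⟩
    obtain ⟨c, rfl⟩ := (P.solEquiv u).surjective ψ
    refine ⟨c 0, c 1, ?_, P.solEquiv_mem_eigenspace_iff.mp h1⟩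
    by_contra! h
    refine h2 ?_
    rw [map_eq_zero_iff _ (P.solEquiv u).injective, funext_iff, Fin.forall_fin_two]
    exact h
  · rintro ⟨α, β, h, h1⟩
    refine ⟨P.solEquiv u ![α, β], P.solEquiv_mem_eigenspace_iff.mpr (by simpa using h1), ?_⟩
    rw [Ne, map_eq_zero_iff _ (P.solEquiv u).injective, funext_iff, Fin.forall_fin_two]
    simpa [imp_iff_not_or] using h

/-! ### The monodromy matrix of the regular Lamé operator -/

/-- The coefficient `u - u₂` of `cosSol ^ 2` in `℘ + u`. -/
def coeffA (u : ℂ) : ℂ := u + P.e₃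

/-- The coefficient `(u - u₀) (u - u₁)` of `sinSol ^ 2` in `℘ + u`. -/
def coeffB (u : ℂ) : ℂ := (u + P.e₁) * (u + P.e₂)

variable {P} in
/-- The function `F = ℘ + u` is a product of two solutions, so the operator `f ↦ F f' - F' f / 2`
maps solutions to solutions. -/
theorem IsLameSolution.commuting {u : ℂ} {f f' : ℝ → ℂ} (hf : P.IsLameSolution u f f') :
    P.IsLameSolution u (fun x => (P.wpShift x + u) * f' x - P.wpShift' x / 2 * f x)
      (fun x => P.wpShift' x / 2 * f' x + ((P.wpShift x + u) * (2 * P.wpShift x - u) -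
        (3 * (P.wpShift x : ℂ) ^ 2 + (P.e₁ * P.e₂ + P.e₁ * P.e₃ + P.e₂ * P.e₃))) * f x) := by
  have h1 : ∀ x, HasDerivAt (fun x => (P.wpShift x : ℂ)) (P.wpShift' x) x := fun x =>
    (P.hasDerivAt_wpShift x).ofReal_comp
  have h2 : ∀ x, HasDerivAt (fun x => (P.wpShift' x : ℂ)) (6 * (P.wpShift x : ℂ) ^ 2 +
      2 * (P.e₁ * P.e₂ + P.e₁ * P.e₃ + P.e₂ * P.e₃)) x := fun x =>
    (P.hasDerivAt_wpShift' x).ofReal_comp.congr_deriv (by push_cast; ring)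
  refine ⟨fun x => ?_, fun x => ?_⟩
  · refine ((((h1 x).add_const u).mul (hf.2 x)).sub
      (((h2 x).div_const 2).mul (hf.1 x))).congr_deriv ?_
    ring
  · refine ((((h2 x).div_const 2).mul (hf.2 x)).add
      (((((h1 x).add_const u).mul (((h1 x).const_mul 2).sub_const u)).sub
        ((((h1 x).pow 2).const_mul 3).add_const _)).mul (hf.1 x))).congr_deriv ?_
    simp only [Pi.mul_apply, Pi.sub_apply, Pi.pow_apply]
    ring

theorem commuting_initial (u : ℂ) : (P.e₃ + u) * (2 * P.e₃ - u) -
    (3 * (P.e₃ : ℂ) ^ 2 + (P.e₁ * P.e₂ + P.e₁ * P.e₃ + P.e₂ * P.e₃)) = -P.coeffB u := by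
  rw [coeffB, P.e₂_eq]
  push_cast
  ring

theorem commuting_cosSol (u : ℂ) (x : ℝ) :
    (P.wpShift x + u) * P.cosSol' u x - P.wpShift' x / 2 * P.cosSol u x =
      -P.coeffB u * P.sinSol u x ∧
    P.wpShift' x / 2 * P.cosSol' u x + ((P.wpShift x + u) * (2 * P.wpShift x - u) -
      (3 * (P.wpShift x : ℂ) ^ 2 + (P.e₁ * P.e₂ + P.e₁ * P.e₃ + P.e₂ * P.e₃))) * P.cosSol u x =
      -P.coeffB u * P.sinSol' u x := by
  have h := (P.isLameSolution_cosSol u).commuting.eq_lin x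
  have h0 : P.wpShift 0 = P.e₃ := rfl
  simpa only [cosSol_zero, cosSol'_zero, wpShift'_zero, h0, commuting_initial, ofReal_zero,
    zero_div, mul_zero, zero_mul, mul_one, sub_self, zero_add] using h

theorem commuting_sinSol (u : ℂ) (x : ℝ) :
    (P.wpShift x + u) * P.sinSol' u x - P.wpShift' x / 2 * P.sinSol u x =
      P.coeffA u * P.cosSol u x := by
  have h := ((P.isLameSolution_sinSol u).commuting.eq_lin x).1
  have h0 : P.wpShift 0 = P.e₃ := rfl
  simp only [sinSol_zero, sinSol'_zero, wpShift'_zero, h0, ofReal_zero, zero_div, mul_zero,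
    zero_mul, mul_one, sub_zero, add_zero] at h
  rw [h, coeffA]
  ring

/-- `℘(x + i ω) + u` as a quadratic form in the fundamental solutions. -/
theorem wpShift_add_eq (u : ℂ) (x : ℝ) : P.wpShift x + u =
    P.coeffA u * P.cosSol u x ^ 2 + P.coeffB u * P.sinSol u x ^ 2 := by
  linear_combination P.cosSol u x * P.commuting_sinSol u x -
    P.sinSol u x * (P.commuting_cosSol u x).1 - (P.wpShift x + u) * P.wronskian_eq_one u x

theorem coeff_ne_zero (u : ℂ) : P.coeffA u ≠ 0 ∨ P.coeffB u ≠ 0 := by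
  by_contra! h
  have h1 : u = -P.e₃ := eq_neg_of_add_eq_zero_left h.1
  have h2 := h.2
  have h3 : ((P.e₁ : ℂ) - P.e₃) ≠ 0 := by rw [sub_ne_zero]; exact_mod_cast P.e₁_ne_e₃
  have h4 : ((P.e₂ : ℂ) - P.e₃) ≠ 0 := by rw [sub_ne_zero]; exact_mod_cast P.e₂_ne_e₃
  refine mul_ne_zero h3 h4 ?_
  rw [coeffB, h1] at h2
  linear_combination h2

/-- The two diagonal entries of the monodromy matrix agree, since the monodromy commutes with the
operator of `IsLameSolution.commuting`. -/
theorem sinSol'_T (u : ℂ) : P.sinSol' u P.T = P.cosSol u P.T := by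
  have h1 := P.commuting_sinSol u P.T
  have h2 := (P.commuting_cosSol u P.T).2
  simp only [wpShift_T, wpShift'_T, commuting_initial, ofReal_zero, zero_div, zero_mul, sub_zero,
    zero_add] at h1 h2
  rcases P.coeff_ne_zero u with h | h
  · refine mul_left_cancel₀ h ?_
    rw [coeffA] at h1 ⊢
    linear_combination h1
  · refine mul_left_cancel₀ h ?_
    linear_combination h2

/-- The off-diagonal entries of the monodromy matrix are proportional to the coefficients of the
invariant quadratic form `℘ + u`. -/
theorem exists_monodromyCoeff (u : ℂ) : ∃ t : ℂ, P.sinSol u P.T = P.coeffA u * t ∧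
    P.cosSol' u P.T = -P.coeffB u * t := by
  have h2 := (P.commuting_cosSol u P.T).1
  simp only [wpShift_T, wpShift'_T, ofReal_zero, zero_div, zero_mul, sub_zero] at h2
  have h3 : P.coeffA u * P.cosSol' u P.T = -P.coeffB u * P.sinSol u P.T := by
    rw [← h2, coeffA]
    ring
  rcases P.coeff_ne_zero u with h | h
  · refine ⟨P.sinSol u P.T / P.coeffA u, by field_simp, ?_⟩
    field_simp
    linear_combination h3
  · refine ⟨-P.cosSol' u P.T / P.coeffB u, ?_, by field_simp⟩
    field_simp
    linear_combination h3

/-- The common factor of the off-diagonal entries of the monodromy matrix. It vanishes exactly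
where the monodromy is scalar. -/
def monodromyCoeff (u : ℂ) : ℂ := (P.exists_monodromyCoeff u).choose

theorem sinSol_T (u : ℂ) : P.sinSol u P.T = P.coeffA u * P.monodromyCoeff u :=
  (P.exists_monodromyCoeff u).choose_spec.1

theorem cosSol'_T (u : ℂ) : P.cosSol' u P.T = -P.coeffB u * P.monodromyCoeff u :=
  (P.exists_monodromyCoeff u).choose_spec.2

theorem halfTrace_eq_cosSol (u : ℂ) : P.halfTrace u = P.cosSol u P.T := by
  rw [halfTrace_eq, sinSol'_T]
  ring

/-- The monodromy matrix has determinant `1`. -/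
theorem halfTrace_sq (u : ℂ) :
    P.halfTrace u ^ 2 = 1 - P.coeffA u * P.coeffB u * P.monodromyCoeff u ^ 2 := by
  have := P.wronskian_eq_one u P.T
  rw [sinSol'_T, sinSol_T, cosSol'_T, ← halfTrace_eq_cosSol] at this
  linear_combination this

theorem eigenspace_eq_top_iff_monodromyCoeff {u ε : ℂ} :
    (P.shiftedMonodromy u).eigenspace ε = ⊤ ↔ P.halfTrace u = ε ∧ P.monodromyCoeff u = 0 := by
  rw [eigenspace_eq_top_iff, sinSol'_T, sinSol_T, cosSol'_T, halfTrace_eq_cosSol]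
  constructor
  · rintro ⟨h1, h2, h3, -⟩
    refine ⟨h1, ?_⟩
    rcases P.coeff_ne_zero u with h | h
    · exact (mul_eq_zero.mp h2).resolve_left h
    · exact (mul_eq_zero.mp h3).resolve_left (neg_ne_zero.mpr h)
  · rintro ⟨h1, h2⟩
    simp [h1, h2]

/-- For `ε = ±1` the characteristic polynomial of the monodromy at `ε` is `2 - 2 ε S(u)`. -/
theorem halfTrace_eq_of_eigenspace_ne_bot {u ε : ℂ} (hε : ε = 1 ∨ ε = -1)
    (h : (P.shiftedMonodromy u).eigenspace ε ≠ ⊥) : P.halfTrace u = ε := by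
  obtain ⟨α, β, h0, h1, h2⟩ := P.eigenspace_ne_bot_iff.mp h
  rw [sinSol_T, ← halfTrace_eq_cosSol] at h1
  rw [sinSol'_T, cosSol'_T, ← halfTrace_eq_cosSol] at h2
  have h3 := P.halfTrace_sq u
  have hε2 : ε ^ 2 = 1 := by rcases hε with rfl | rfl <;> norm_num
  have hα : α * (2 * ε * (ε - P.halfTrace u)) = 0 := by
    linear_combination (P.halfTrace u - ε) * h1 - P.coeffA u * P.monodromyCoeff u * h2 -
      α * h3 + α * hε2
  have hβ : β * (2 * ε * (ε - P.halfTrace u)) = 0 := by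
    linear_combination (P.halfTrace u - ε) * h2 + P.coeffB u * P.monodromyCoeff u * h1 -
      β * h3 + β * hε2
  have hne : 2 * ε ≠ 0 := by rcases hε with rfl | rfl <;> norm_num
  have : ε - P.halfTrace u = 0 := by
    rcases h0 with h0 | h0
    · exact (mul_eq_zero.mp ((mul_eq_zero.mp hα).resolve_left h0)).resolve_left hne
    · exact (mul_eq_zero.mp ((mul_eq_zero.mp hβ).resolve_left h0)).resolve_left hne
  linear_combination -this

theorem periodicEigenvalues_two : P.periodicEigenvalues 2 = {u | P.monodromyCoeff u = 0} := by
  ext u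
  simp only [periodicEigenvalues, Set.mem_ofPred_eq]
  constructor
  · rintro ⟨ε, hε, h⟩
    rw [← P.finrank_solutionSpace u] at h
    exact (P.eigenspace_eq_top_iff_monodromyCoeff.mp (Submodule.eq_top_of_finrank_eq h)).2
  · intro h
    have h1 := P.halfTrace_sq u
    rw [h] at h1
    refine ⟨P.halfTrace u, sq_eq_sq_iff_eq_or_eq_neg.mp ?_, ?_⟩
    · linear_combination h1
    · rw [P.eigenspace_eq_top_iff_monodromyCoeff.mpr ⟨rfl, h⟩, finrank_top,
        finrank_solutionSpace]

theorem periodicEigenvalues_one : P.periodicEigenvalues 1 =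
    {u | P.monodromyCoeff u ≠ 0 ∧ P.coeffA u * P.coeffB u = 0} := by
  ext u
  simp only [periodicEigenvalues, Set.mem_ofPred_eq]
  constructor
  · rintro ⟨ε, hε, h⟩
    have hS := P.halfTrace_eq_of_eigenspace_ne_bot hε (u := u) (by
      intro hb
      rw [hb, finrank_bot] at h
      exact zero_ne_one h)
    have ht : P.monodromyCoeff u ≠ 0 := by
      intro ht
      rw [P.eigenspace_eq_top_iff_monodromyCoeff.mpr ⟨hS, ht⟩, finrank_top,
        finrank_solutionSpace] at h
      norm_num at h
    have h1 := P.halfTrace_sq u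
    have hε2 : ε ^ 2 = 1 := by rcases hε with rfl | rfl <;> norm_num
    refine ⟨ht, (mul_eq_zero.mp (?_ : _ * P.monodromyCoeff u ^ 2 = 0)).resolve_right
      (pow_ne_zero 2 ht)⟩
    rw [hS] at h1
    linear_combination h1 - hε2
  · rintro ⟨ht, hab⟩
    have h1 := P.halfTrace_sq u
    rw [hab] at h1
    refine ⟨P.halfTrace u, sq_eq_sq_iff_eq_or_eq_neg.mp (by linear_combination h1), ?_⟩
    have hbot : (P.shiftedMonodromy u).eigenspace (P.halfTrace u) ≠ ⊥ := by
      rw [eigenspace_ne_bot_iff]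
      rcases mul_eq_zero.mp hab with h | h
      · refine ⟨0, 1, by simp, ?_, ?_⟩
        · simp [sinSol_T, h]
        · simp [sinSol'_T, halfTrace_eq_cosSol]
      · refine ⟨1, 0, by simp, ?_, ?_⟩
        · simp [halfTrace_eq_cosSol]
        · simp [cosSol'_T, h]
    have htop : (P.shiftedMonodromy u).eigenspace (P.halfTrace u) ≠ ⊤ := fun h =>
      ht (P.eigenspace_eq_top_iff_monodromyCoeff.mp h).2
    have hlt := Submodule.finrank_lt htop
    rw [finrank_solutionSpace] at hlt
    have hpos := Submodule.one_le_finrank_iff.mpr hbot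
    omega

/-! ### The derivative of the half-trace -/

theorem continuous_integral_mul {f : ℂ → ℝ → ℂ} (hf : Continuous fun p : ℂ × ℝ => f p.1 p.2)
    {g : ℝ → ℂ} (hg : Continuous g) (a b : ℝ) :
    Continuous fun u => ∫ x in a..b, f u x * g x :=
  intervalIntegral.continuous_parametric_intervalIntegral_of_continuous'
    (f := fun u x => f u x * g x) (hf.mul (hg.comp continuous_snd)) a b

/-- By the Wronskian identity the difference quotient of `S` at `v` is an integral of products of
solutions at the two values of the parameter. On the diagonal these products combine to the
quadratic form `℘ + v`. -/
theorem hasDerivAt_halfTrace (v : ℂ) : HasDerivAt P.halfTrace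
    (-(1 / 2) * P.monodromyCoeff v * ∫ x in (0 : ℝ)..P.T, ((P.wpShift x : ℂ) + v)) v := by
  have hc := P.isLameSolution_cosSol
  have hs := P.isLameSolution_sinSol
  -- the difference quotient of `S` at `v`, extended continuously to `v`
  set K : ℂ → ℂ := fun u => (1 / 2) * (
    (P.cosSol v P.T * ∫ x in (0 : ℝ)..P.T, P.cosSol u x * P.sinSol v x) -
    (P.sinSol v P.T * ∫ x in (0 : ℝ)..P.T, P.cosSol u x * P.cosSol v x) +
    (P.cosSol' v P.T * ∫ x in (0 : ℝ)..P.T, P.sinSol u x * P.sinSol v x) -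
    P.sinSol' v P.T * ∫ x in (0 : ℝ)..P.T, P.sinSol u x * P.cosSol v x) with hK
  have hKc : Continuous K := by
    have k1 := continuous_integral_mul P.continuous_cosSol (hs v).continuous 0 P.T
    have k2 := continuous_integral_mul P.continuous_cosSol (hc v).continuous 0 P.T
    have k3 := continuous_integral_mul P.continuous_sinSol (hs v).continuous 0 P.T
    have k4 := continuous_integral_mul P.continuous_sinSol (hc v).continuous 0 P.T
    fun_prop
  have hdiff : ∀ u, P.halfTrace u - P.halfTrace v = (u - v) * K u := by
    intro u
    have i1 := (hc u).mul_integral (hs v) 0 P.T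
    have i2 := (hc u).mul_integral (hc v) 0 P.T
    have i3 := (hs u).mul_integral (hs v) 0 P.T
    have i4 := (hs u).mul_integral (hc v) 0 P.T
    simp only [cosSol_zero, sinSol'_zero, cosSol'_zero, sinSol_zero] at i1 i2 i3 i4
    rw [halfTrace_eq, halfTrace_eq, hK]
    have w := P.wronskian_eq_one v P.T
    linear_combination (-1 / 2) * (P.cosSol v P.T * i1 - P.sinSol v P.T * i2 +
      P.cosSol' v P.T * i3 - P.sinSol' v P.T * i4) -
      (P.cosSol u P.T + P.sinSol' u P.T) / 2 * w
  have hKv : K v = -(1 / 2) * P.monodromyCoeff v *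
      ∫ x in (0 : ℝ)..P.T, ((P.wpShift x : ℂ) + v) := by
    have e : ∀ x, (P.wpShift x : ℂ) + v = P.coeffA v * (P.cosSol v x * P.cosSol v x) +
        P.coeffB v * (P.sinSol v x * P.sinSol v x) := fun x => by
      rw [wpShift_add_eq]; ring
    have c1 : Continuous fun x => P.coeffA v * (P.cosSol v x * P.cosSol v x) :=
      continuous_const.mul ((hc v).continuous.mul (hc v).continuous)
    have c2 : Continuous fun x => P.coeffB v * (P.sinSol v x * P.sinSol v x) :=
      continuous_const.mul ((hs v).continuous.mul (hs v).continuous)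
    simp only [e]
    rw [intervalIntegral.integral_add (c1.intervalIntegrable _ _) (c2.intervalIntegrable _ _),
      intervalIntegral.integral_const_mul, intervalIntegral.integral_const_mul, hK]
    simp only [sinSol'_T, sinSol_T, cosSol'_T, mul_comm (P.sinSol v _) (P.cosSol v _)]
    ring
  rw [← hKv, hasDerivAt_iff_tendsto_slope]
  refine ((hKc.tendsto v).mono_left nhdsWithin_le_nhds).congr' ?_
  filter_upwards [self_mem_nhdsWithin] with u hu
  have hne : u - v ≠ 0 := sub_ne_zero.mpr hu
  rw [slope_def_field, hdiff, mul_div_cancel_left₀ _ hne]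

/-! ### Sturm comparison: the scalar monodromies lie above `u₂` -/

/-- The real part of `cosSol`, which is real at real values of the spectral parameter. -/
def cosR (u x : ℝ) : ℝ := (P.cosSol u x).re

/-- The derivative of `cosR`. -/
def cosR' (u x : ℝ) : ℝ := (P.cosSol' u x).re

/-- The real part of `sinSol`, which is real at real values of the spectral parameter. -/
def sinR (u x : ℝ) : ℝ := (P.sinSol u x).re

/-- The derivative of `sinR`. -/
def sinR' (u x : ℝ) : ℝ := (P.sinSol' u x).re

theorem ofReal_cosR (u x : ℝ) : (P.cosR u x : ℂ) = P.cosSol u x ∧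
    (P.cosR' u x : ℂ) = P.cosSol' u x := by
  have h := (P.isLameSolution_cosSol u).conjugate
  rw [conj_ofReal] at h
  have := h.eq_of_initial (P.isLameSolution_cosSol u) 0 (by simp) (by simp) x
  exact ⟨Complex.conj_eq_iff_re.mp this.1, Complex.conj_eq_iff_re.mp this.2⟩

theorem ofReal_sinR (u x : ℝ) : (P.sinR u x : ℂ) = P.sinSol u x ∧
    (P.sinR' u x : ℂ) = P.sinSol' u x := by
  have h := (P.isLameSolution_sinSol u).conjugate
  rw [conj_ofReal] at h
  have := h.eq_of_initial (P.isLameSolution_sinSol u) 0 (by simp) (by simp) x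
  exact ⟨Complex.conj_eq_iff_re.mp this.1, Complex.conj_eq_iff_re.mp this.2⟩

/-- Real solutions of the regular Lamé equation, with their derivatives. -/
def IsRealSolution (u : ℝ) (f f' : ℝ → ℝ) : Prop :=
  (∀ x, HasDerivAt f (f' x) x) ∧ ∀ x, HasDerivAt f' ((2 * P.wpShift x - u) * f x) x

variable {P} in
theorem IsLameSolution.re {u : ℝ} {f f' : ℝ → ℂ} (hf : P.IsLameSolution u f f') :
    P.IsRealSolution u (fun x => (f x).re) (fun x => (f' x).re) := by
  refine ⟨fun x => ?_, fun x => ?_⟩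
  · exact Complex.reCLM.hasFDerivAt.comp_hasDerivAt x (hf.1 x)
  · refine (Complex.reCLM.hasFDerivAt.comp_hasDerivAt x (hf.2 x)).congr_deriv ?_
    have e : (2 * (P.wpShift x : ℂ) - u) = ((2 * P.wpShift x - u : ℝ) : ℂ) := by push_cast; rfl
    rw [reCLM_apply, e, re_ofReal_mul]

theorem isRealSolution_cosR (u : ℝ) : P.IsRealSolution u (P.cosR u) (P.cosR' u) :=
  (P.isLameSolution_cosSol u).re

theorem isRealSolution_sinR (u : ℝ) : P.IsRealSolution u (P.sinR u) (P.sinR' u) :=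
  (P.isLameSolution_sinSol u).re

@[simp] theorem cosR_zero (u : ℝ) : P.cosR u 0 = 1 := by simp [cosR]

@[simp] theorem cosR'_zero (u : ℝ) : P.cosR' u 0 = 0 := by simp [cosR']

@[simp] theorem sinR_zero (u : ℝ) : P.sinR u 0 = 0 := by simp [sinR]

@[simp] theorem sinR'_zero (u : ℝ) : P.sinR' u 0 = 1 := by simp [sinR']

theorem wronskian_real (u x : ℝ) :
    P.cosR u x * P.sinR' u x - P.cosR' u x * P.sinR u x = 1 := by
  have := P.wronskian_eq_one u x
  rw [← (P.ofReal_cosR u x).1, ← (P.ofReal_cosR u x).2, ← (P.ofReal_sinR u x).1,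
    ← (P.ofReal_sinR u x).2] at this
  exact_mod_cast this

namespace IsRealSolution

variable {P} {u v : ℝ} {f f' g g' : ℝ → ℝ}

theorem continuous (hf : P.IsRealSolution u f f') : Continuous f :=
  continuous_iff_continuousAt.mpr fun x => (hf.1 x).continuousAt

theorem continuous' (hf : P.IsRealSolution u f f') : Continuous f' :=
  continuous_iff_continuousAt.mpr fun x => (hf.2 x).continuousAt

theorem mul_integral (hf : P.IsRealSolution u f f') (hg : P.IsRealSolution v g g')
    (a b : ℝ) : (u - v) * ∫ x in a..b, f x * g x =
      f b * g' b - f' b * g b - (f a * g' a - f' a * g a) := by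
  rw [← intervalIntegral.integral_const_mul]
  refine intervalIntegral.integral_eq_sub_of_hasDerivAt
    (f := fun x => f x * g' x - f' x * g x) (fun x _ => ?_) ?_
  · exact (((hf.1 x).mul (hg.2 x)).sub ((hf.2 x).mul (hg.1 x))).congr_deriv (by ring)
  · exact (continuous_const.mul (hf.continuous.mul hg.continuous)).intervalIntegrable _ _

end IsRealSolution

theorem eventually_pos_right {f : ℝ → ℝ} {f' a : ℝ} (hf : HasDerivAt f f' a) (h0 : f a = 0)
    (h1 : 0 < f') : ∀ᶠ x in 𝓝[>] a, 0 < f x := by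
  have h2 := (hasDerivAt_iff_tendsto_slope.mp hf).mono_left
    (nhdsWithin_mono a fun x (hx : a < x) => hx.ne')
  filter_upwards [h2.eventually (lt_mem_nhds h1), self_mem_nhdsWithin] with x hx hax
  rw [slope_def_field, h0, sub_zero] at hx
  exact (div_pos_iff_of_pos_right (sub_pos.mpr hax)).mp hx

theorem deriv_nonpos_of_pos_left {f : ℝ → ℝ} {f' a s : ℝ} (has : a < s) (hf : HasDerivAt f f' s)
    (h0 : f s = 0) (h1 : ∀ x ∈ Set.Ioo a s, 0 < f x) : f' ≤ 0 := by
  have h2 := (hasDerivAt_iff_tendsto_slope.mp hf).mono_left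
    (nhdsWithin_mono (s := Set.Iio s) s fun x (hx : x < s) => hx.ne)
  refine le_of_tendsto h2 ?_
  filter_upwards [Ioo_mem_nhdsLT has] with x hx
  rw [slope_def_field, h0, sub_zero]
  exact (div_neg_of_pos_of_neg (h1 x hx) (sub_neg.mpr hx.2)).le

theorem exists_sinSol_ne_zero (u : ℂ) : ∃ x ∈ Set.Ioo 0 P.T, P.sinSol u x ≠ 0 := by
  by_contra! h
  have h1 : P.sinSol u =ᶠ[𝓝 (P.T / 2)] fun _ => 0 := by
    filter_upwards [Ioo_mem_nhds P.half_mem_Ioo.1 P.half_mem_Ioo.2] with x hx using h x hx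
  have h2 := ((P.isLameSolution_sinSol u).1 (P.T / 2)).unique
    ((hasDerivAt_const _ _).congr_of_eventuallyEq h1)
  have h3 := P.wronskian_eq_one u (P.T / 2)
  rw [h2, h _ P.half_mem_Ioo] at h3
  simp at h3

/-- Dirichlet eigenvalues of the regular operator are real. -/
theorem conj_eq_of_sinSol_T_eq_zero {u : ℂ} (h : P.sinSol u P.T = 0) : conj u = u := by
  have h1 := P.isLameSolution_sinSol u
  have h2 := h1.mul_integral h1.conjugate 0 P.T
  simp only [h, sinSol_zero, map_zero, mul_zero, zero_mul, sub_self] at h2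
  have h3 : (∫ x in (0 : ℝ)..P.T, P.sinSol u x * conj (P.sinSol u x)) ≠ 0 := by
    simp only [mul_conj]
    rw [intervalIntegral.integral_ofReal, ofReal_ne_zero]
    obtain ⟨c, hc, hc0⟩ := P.exists_sinSol_ne_zero u
    refine (intervalIntegral.integral_pos P.T_pos ?_ (fun x _ => normSq_nonneg _)
      ⟨c, ⟨hc.1.le, hc.2.le⟩, normSq_pos.mpr hc0⟩).ne'
    exact (Complex.continuous_normSq.comp h1.continuous).continuousOn
  exact (sub_eq_zero.mp ((mul_eq_zero.mp h2).resolve_right h3)).symm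

theorem coeffB_neg_e₃ : P.coeffB (-P.e₃ : ℝ) = ((P.e₃ - P.e₁) * (P.e₃ - P.e₂) : ℝ) := by
  rw [coeffB]
  push_cast
  ring

theorem prod_pos : 0 < (P.e₃ - P.e₁) * (P.e₃ - P.e₂) :=
  mul_pos_of_neg_of_neg (sub_neg.mpr (P.e₃_lt_e₂.trans P.e₂_lt_e₁)) (sub_neg.mpr P.e₃_lt_e₂)

/-- At the branching point `u₂` the function `℘ + u₂` is a multiple of `sinR ^ 2`. -/
theorem wpShift_sub_e₃ (x : ℝ) : P.wpShift x - P.e₃ =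
    (P.e₃ - P.e₁) * (P.e₃ - P.e₂) * P.sinR (-P.e₃) x ^ 2 := by
  have h := P.wpShift_add_eq (-P.e₃ : ℝ) x
  rw [coeffB_neg_e₃, coeffA, ← (P.ofReal_sinR (-P.e₃) x).1] at h
  push_cast at h
  rw [neg_add_cancel, zero_mul, zero_add, ← sub_eq_add_neg] at h
  exact_mod_cast h

/-- At the branching point `u₁` the function `℘ + u₁` is a multiple of `cosR ^ 2`. -/
theorem wpShift_sub_e₂ (x : ℝ) : P.wpShift x - P.e₂ =
    (P.e₃ - P.e₂) * P.cosR (-P.e₂) x ^ 2 := by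
  have h := P.wpShift_add_eq (-P.e₂ : ℝ) x
  rw [coeffB, coeffA, ← (P.ofReal_cosR (-P.e₂) x).1] at h
  push_cast at h
  rw [neg_add_cancel, mul_zero, zero_mul, add_zero, ← sub_eq_add_neg, neg_add_eq_sub] at h
  exact_mod_cast h

/-- `sinR u₂` is the Dirichlet ground state of the regular operator. -/
theorem sinR_pos {x : ℝ} (hx : x ∈ Set.Ioo 0 P.T) : 0 < P.sinR (-P.e₃) x := by
  have hs := P.isRealSolution_sinR (-P.e₃)
  obtain ⟨z, hz, hzT⟩ := ((eventually_pos_right (hs.1 0) (P.sinR_zero _)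
    (by simp)).and (Ioo_mem_nhdsGT P.T_pos)).exists
  refine lt_of_continuousOn_of_ne Set.ordConnected_Ioo hs.continuous.continuousOn hzT hz
    (fun w hw h => ?_) hx
  have h1 := P.wpShift_sub_e₃ w
  rw [h] at h1
  have := P.e₃_lt_wpShift hw
  nlinarith

theorem sinR_e₃_T : P.sinR (-P.e₃) P.T = 0 := by
  have h1 := P.wpShift_sub_e₃ P.T
  rw [wpShift_T, sub_self] at h1
  exact pow_eq_zero_iff two_ne_zero |>.mp ((mul_eq_zero.mp h1.symm).resolve_left P.prod_pos.ne')

/-- No Dirichlet eigenvalue lies below that of the ground state: at its first positive zero a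
solution with smaller spectral parameter violates the Wronskian identity. -/
theorem sinR_T_ne_zero {u : ℝ} (hu : u < -P.e₃) : P.sinR u P.T ≠ 0 := by
  intro hT
  have hs := P.isRealSolution_sinR u
  have hg := P.isRealSolution_sinR (-P.e₃)
  obtain ⟨δ, hδ, hδpos⟩ : ∃ δ > 0, ∀ x ∈ Set.Ioo 0 δ, 0 < P.sinR u x := by
    obtain ⟨δ, hδ, h⟩ := mem_nhdsGT_iff_exists_Ioo_subset.mp
      (eventually_pos_right (hs.1 0) (P.sinR_zero _) (by simp))
    exact ⟨δ, hδ, fun x hx => h hx⟩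
  have hδT : δ ≤ P.T := by
    by_contra! h
    exact (hδpos P.T ⟨P.T_pos, h⟩).ne' hT
  have hcomp : IsCompact (Set.Icc δ P.T ∩ P.sinR u ⁻¹' {0}) :=
    isCompact_Icc.inter_right (isClosed_singleton.preimage hs.continuous)
  obtain ⟨s, ⟨hsI, hs0⟩, hsmin⟩ := hcomp.exists_isLeast ⟨P.T, ⟨hδT, le_rfl⟩, hT⟩
  have hspos : 0 < s := lt_of_lt_of_le hδ hsI.1
  have hpos : ∀ x ∈ Set.Ioo 0 s, 0 < P.sinR u x := by
    intro x hx
    have hδ2 : min δ s / 2 ∈ Set.Ioo 0 s := by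
      have := lt_min hδ hspos
      exact ⟨by linarith, by linarith [min_le_right δ s]⟩
    refine lt_of_continuousOn_of_ne Set.ordConnected_Ioo hs.continuous.continuousOn hδ2
      (hδpos _ ⟨hδ2.1, by linarith [min_le_left δ s, lt_min hδ hspos]⟩) (fun w hw h => ?_) hx
    by_cases hwδ : w < δ
    · exact (hδpos w ⟨hw.1, hwδ⟩).ne' h
    · exact hw.2.not_ge (hsmin ⟨⟨not_lt.mp hwδ, hw.2.le.trans hsI.2⟩, h⟩)
  have hd := deriv_nonpos_of_pos_left hspos (hs.1 s) hs0 hpos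
  have hW := hs.mul_integral hg 0 s
  have hint : 0 < ∫ x in (0 : ℝ)..s, P.sinR u x * P.sinR (-P.e₃) x :=
    intervalIntegral.intervalIntegral_pos_of_pos_on
      ((hs.continuous.mul hg.continuous).intervalIntegrable _ _)
      (fun x hx => mul_pos (hpos x hx) (P.sinR_pos ⟨hx.1, hx.2.trans_le hsI.2⟩)) hspos
  have hg0 : 0 ≤ P.sinR (-P.e₃) s := by
    rcases hsI.2.eq_or_lt with h | h
    · rw [h, sinR_e₃_T]
    · exact (P.sinR_pos ⟨hspos, h⟩).le
  have hs0' : P.sinR u s = 0 := hs0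
  simp only [hs0', sinR_zero, zero_mul, mul_zero, sub_self, sub_zero, zero_sub] at hW
  nlinarith [mul_nonneg (neg_nonneg.mpr hd) hg0]

theorem cosR_e₂_pos {x : ℝ} (hx : x ∈ Set.Ico 0 (P.T / 2)) : 0 < P.cosR (-P.e₂) x := by
  refine lt_of_continuousOn_of_ne Set.ordConnected_Ico
    (P.isRealSolution_cosR _).continuous.continuousOn (x₀ := 0) ⟨le_rfl, P.half_mem_Ioo.1⟩
    (by simp) (fun w hw h => ?_) hx
  have h1 := P.wpShift_sub_e₂ w
  rw [h] at h1
  have := P.wpShift_lt_e₂ hw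
  nlinarith

theorem cosR_e₂_half : P.cosR (-P.e₂) (P.T / 2) = 0 := by
  have h1 := P.wpShift_sub_e₂ (P.T / 2)
  rw [show P.wpShift (P.T / 2) = P.e₂ from rfl, sub_self] at h1
  exact pow_eq_zero_iff two_ne_zero |>.mp
    ((mul_eq_zero.mp h1.symm).resolve_left (sub_ne_zero.mpr P.e₂_ne_e₃.symm))

/-- At `u₂` the quotient `cosR / sinR` is strictly decreasing on `(0, T)`, so a zero of `cosR` at
`T / 2` is its first positive zero. -/
theorem cosR_e₃_pos (h : P.cosR (-P.e₃) (P.T / 2) = 0) {x : ℝ}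
    (hx : x ∈ Set.Ico 0 (P.T / 2)) : 0 < P.cosR (-P.e₃) x := by
  have hc := P.isRealSolution_cosR (-P.e₃)
  have hs := P.isRealSolution_sinR (-P.e₃)
  refine lt_of_continuousOn_of_ne Set.ordConnected_Ico hc.continuous.continuousOn
    (x₀ := 0) ⟨le_rfl, P.half_mem_Ioo.1⟩ (by simp) (fun w hw h0 => ?_) hx
  have hw0 : 0 < w := by
    refine lt_of_le_of_ne hw.1 ?_
    rintro rfl
    simp at h0
  have hder : ∀ x ∈ Set.Ioo 0 P.T, HasDerivAt (fun x => P.cosR (-P.e₃) x / P.sinR (-P.e₃) x)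
      (-1 / P.sinR (-P.e₃) x ^ 2) x := by
    intro x hx
    refine ((hc.1 x).div (hs.1 x) (P.sinR_pos hx).ne').congr_deriv ?_
    congr 1
    linear_combination -P.wronskian_real (-P.e₃) x
  have hanti : StrictAntiOn (fun x => P.cosR (-P.e₃) x / P.sinR (-P.e₃) x) (Set.Ioo 0 P.T) := by
    refine strictAntiOn_of_deriv_neg (convex_Ioo _ _)
      (fun x hx => (hder x hx).continuousAt.continuousWithinAt) fun x hx => ?_
    rw [interior_Ioo] at hx
    rw [(hder x hx).deriv]
    exact div_neg_of_neg_of_pos (by norm_num) (pow_pos (P.sinR_pos hx) 2)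
  have := hanti ⟨hw0, hw.2.trans P.half_mem_Ioo.2⟩ P.half_mem_Ioo hw.2
  simp [h0, h] at this

/-- The monodromy at `u₂` is not scalar. If it were, it would be `-1` since `sinSol` is odd and
positive on `(0, T)`; the even solution would then vanish at `T / 2`, as the even solution at `u₁`
does, although both are positive on `[0, T / 2)`. -/
theorem monodromyCoeff_e₃_ne_zero : P.monodromyCoeff (-P.e₃ : ℝ) ≠ 0 := by
  intro ht
  have hS := P.halfTrace_eq_cosSol (-P.e₃ : ℝ)
  set ε := P.halfTrace (-P.e₃ : ℝ)
  have hs := ((P.isLameSolution_sinSol (-P.e₃ : ℝ)).translate.eq_lin (-(P.T / 2))).1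
  have hc := ((P.isLameSolution_cosSol (-P.e₃ : ℝ)).translate.eq_lin (-(P.T / 2))).1
  have e : -(P.T / 2) + P.T = P.T / 2 := by ring
  simp only [zero_add, sinSol_T, cosSol'_T, sinSol'_T, ht, mul_zero, zero_mul, add_zero, ← hS, e,
    cosSol_neg, sinSol_neg] at hs hc
  have hpos := P.sinR_pos P.half_mem_Ioo
  have hne : P.sinSol (-P.e₃ : ℝ) (P.T / 2) ≠ 0 := by
    rw [← (P.ofReal_sinR _ _).1, ofReal_ne_zero]
    exact hpos.ne'
  have hε : ε = -1 := mul_right_cancel₀ hne (by linear_combination hs)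
  have hc0 : P.cosSol (-P.e₃ : ℝ) (P.T / 2) = 0 := by
    rw [hε] at hc
    linear_combination (1 / 2) * hc
  have hcR : P.cosR (-P.e₃) (P.T / 2) = 0 := by rw [cosR, hc0, zero_re]
  have h3 := P.isRealSolution_cosR (-P.e₃)
  have h2 := P.isRealSolution_cosR (-P.e₂)
  have hW := h3.mul_integral h2 0 (P.T / 2)
  have hint : 0 < ∫ x in (0 : ℝ)..(P.T / 2), P.cosR (-P.e₃) x * P.cosR (-P.e₂) x :=
    intervalIntegral.intervalIntegral_pos_of_pos_on
      ((h3.continuous.mul h2.continuous).intervalIntegrable _ _)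
      (fun x hx => mul_pos (P.cosR_e₃_pos hcR ⟨hx.1.le, hx.2⟩) (P.cosR_e₂_pos ⟨hx.1.le, hx.2⟩))
      P.half_mem_Ioo.1
  simp only [hcR, cosR_e₂_half, cosR_zero, cosR'_zero, zero_mul, mul_zero, sub_self] at hW
  have := P.e₃_lt_e₂
  nlinarith

/-- Scalar monodromies occur only at real values above `u₂`. -/
theorem exists_real_of_monodromyCoeff_eq_zero {u : ℂ} (h : P.monodromyCoeff u = 0) :
    ∃ r : ℝ, u = r ∧ -P.e₃ < r := by
  have h1 : P.sinSol u P.T = 0 := by rw [sinSol_T, h, mul_zero]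
  obtain ⟨r, rfl⟩ := Complex.conj_eq_iff_real.mp (P.conj_eq_of_sinSol_T_eq_zero h1)
  refine ⟨r, rfl, ?_⟩
  rcases lt_trichotomy r (-P.e₃) with hr | rfl | hr
  · exact absurd (by rw [sinR, h1, zero_re]) (P.sinR_T_ne_zero hr)
  · exact absurd h P.monodromyCoeff_e₃_ne_zero
  · exact hr

theorem integral_wpShift_sub_ne_zero {c : ℝ} (hc : c = P.e₁ ∨ c = P.e₂ ∨ c = P.e₃) :
    (∫ x in (0 : ℝ)..P.T, (P.wpShift x - c)) ≠ 0 := by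
  have hcont : Continuous fun x => P.wpShift x - c := P.continuous_wpShift.sub continuous_const
  have h12 := P.e₂_lt_e₁
  have h23 := P.e₃_lt_e₂
  by_cases h : c = P.e₃
  · refine (intervalIntegral.integral_pos P.T_pos hcont.continuousOn
      (fun x hx => sub_nonneg.mpr (h ▸ (P.wpShift_mem_Icc' x).1))
      ⟨P.T / 2, ⟨P.half_mem_Ioo.1.le, P.half_mem_Ioo.2.le⟩, ?_⟩).ne'
    rw [h]
    exact sub_pos.mpr h23
  · have hc2 : P.e₂ ≤ c := by
      rcases hc with hc | hc | hc
      · linarith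
      · exact hc.ge
      · exact absurd hc h
    have h0 : P.wpShift 0 = P.e₃ := rfl
    rw [← neg_ne_zero, ← intervalIntegral.integral_neg]
    refine (intervalIntegral.integral_pos P.T_pos hcont.neg.continuousOn
      (fun x hx => ?_) ⟨0, ⟨le_rfl, P.T_pos.le⟩, ?_⟩).ne'
    · exact neg_nonneg.mpr (sub_nonpos.mpr ((P.wpShift_mem_Icc' x).2.trans hc2))
    · change 0 < -(P.wpShift 0 - c)
      rw [h0]
      linarith

theorem eq_neg_e_of_coeff_mul_eq_zero {u : ℂ} (h : P.coeffA u * P.coeffB u = 0) :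
    ∃ c : ℝ, u = -c ∧ (c = P.e₁ ∨ c = P.e₂ ∨ c = P.e₃) := by
  rw [coeffA, coeffB, mul_eq_zero, mul_eq_zero] at h
  rcases h with h | h | h
  · exact ⟨_, eq_neg_of_add_eq_zero_left h, Or.inr (Or.inr rfl)⟩
  · exact ⟨_, eq_neg_of_add_eq_zero_left h, Or.inl rfl⟩
  · exact ⟨_, eq_neg_of_add_eq_zero_left h, Or.inr (Or.inl rfl)⟩

/-- The derivative of `S` is `monodromyCoeff` times a factor that does not vanish at the branching
points. -/
theorem setOf_halfTrace_eq : {u : ℂ | (P.halfTrace u = 1 ∨ P.halfTrace u = -1) ∧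
    HasDerivAt P.halfTrace 0 u} = {u | P.monodromyCoeff u = 0} := by
  ext u
  simp only [Set.mem_ofPred_eq]
  have hsq := P.halfTrace_sq u
  have hder := P.hasDerivAt_halfTrace u
  constructor
  · rintro ⟨hS, hd⟩
    by_contra ht
    have h1 : P.halfTrace u ^ 2 = 1 := by rcases hS with h | h <;> rw [h] <;> norm_num
    have hab : P.coeffA u * P.coeffB u = 0 :=
      (mul_eq_zero.mp (by linear_combination hsq - h1 :
        P.coeffA u * P.coeffB u * P.monodromyCoeff u ^ 2 = 0)).resolve_right (pow_ne_zero 2 ht)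
    obtain ⟨c, rfl, hc⟩ := P.eq_neg_e_of_coeff_mul_eq_zero hab
    have h2 := hder.unique hd
    have h3 := (mul_eq_zero.mp h2).resolve_left (mul_ne_zero (by norm_num) ht)
    refine P.integral_wpShift_sub_ne_zero hc ?_
    rw [← ofReal_eq_zero, ← intervalIntegral.integral_ofReal, ← h3]
    simp [sub_eq_add_neg]
  · intro ht
    rw [ht] at hder hsq
    refine ⟨sq_eq_sq_iff_eq_or_eq_neg.mp (by linear_combination hsq), by simpa using hder⟩

theorem coeff_mul_eq_zero_iff {u : ℂ} : P.coeffA u * P.coeffB u = 0 ↔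
    u ∈ ({((-P.e₁ : ℝ) : ℂ), ((-P.e₂ : ℝ) : ℂ), ((-P.e₃ : ℝ) : ℂ)} : Set ℂ) := by
  simp only [coeffA, coeffB, mul_eq_zero, add_eq_zero_iff_eq_neg, Set.mem_insert_iff,
    Set.mem_singleton_iff, ofReal_neg]
  tauto

theorem periodicEigenvalues_one_eq : P.periodicEigenvalues 1 =
    {((-P.e₁ : ℝ) : ℂ), ((-P.e₂ : ℝ) : ℂ), ((-P.e₃ : ℝ) : ℂ)} := by
  rw [periodicEigenvalues_one]
  ext u
  simp only [Set.mem_ofPred_eq, coeff_mul_eq_zero_iff]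
  refine and_iff_right_of_imp fun hu ht => ?_
  obtain ⟨r, rfl, hr⟩ := P.exists_real_of_monodromyCoeff_eq_zero ht
  have h12 := P.e₂_lt_e₁
  have h23 := P.e₃_lt_e₂
  simp only [Set.mem_insert_iff, Set.mem_singleton_iff, ofReal_inj] at hu
  rcases hu with rfl | rfl | rfl <;> linarith

theorem halfTrace_mem_Icc {u : ℝ} (hu : -P.e₃ ≤ u) :
    ∃ s ∈ Set.Icc (-1 : ℝ) 1, P.halfTrace u = s := by
  have h12 := P.e₂_lt_e₁
  have h23 := P.e₃_lt_e₂
  have hS : P.halfTrace u = P.cosR u P.T := by rw [halfTrace_eq_cosSol, (P.ofReal_cosR _ _).1]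
  refine ⟨P.cosR u P.T, ?_, hS⟩
  rw [Set.mem_Icc, ← abs_le, ← sq_le_one_iff_abs_le_one]
  have h1 := P.wronskian_real u P.T
  have h2 : P.sinR' u P.T = P.cosR u P.T := by rw [sinR', sinSol'_T, cosR]
  -- the product of the off-diagonal entries has the sign of `-(u - u₀) (u - u₁) (u - u₂)`
  have h3 : (u + P.e₃) * P.cosR' u P.T = -((u + P.e₁) * (u + P.e₂)) * P.sinR u P.T := by
    have h : P.coeffA u * P.cosSol' u P.T = -P.coeffB u * P.sinSol u P.T := by
      rw [cosSol'_T, sinSol_T]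
      ring
    rw [← (P.ofReal_cosR _ _).2, ← (P.ofReal_sinR _ _).1, coeffA, coeffB] at h
    exact_mod_cast h
  have hb : 0 < (u + P.e₁) * (u + P.e₂) := mul_pos (by linarith) (by linarith)
  rw [h2] at h1
  have h4 : (u + P.e₁) * (u + P.e₂) * (1 - P.cosR u P.T ^ 2) =
      (u + P.e₃) * P.cosR' u P.T ^ 2 := by
    linear_combination -(u + P.e₁) * (u + P.e₂) * h1 - P.cosR' u P.T * h3
  have h5 : 0 ≤ 1 - P.cosR u P.T ^ 2 := by
    rw [← mul_nonneg_iff_of_pos_left hb, h4]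
    exact mul_nonneg (by linarith) (sq_nonneg _)
  linarith

/-! ### The scalar monodromies form an increasing sequence -/

/-- For `r > u₂` put `Z = √a cosSol + i √b sinSol`. Then `Z / conj Z` rotates with angular velocity
`2 √(a b) / (℘ + r)`, and the monodromy is scalar as soon as it makes a whole number of turns over
a period. -/
theorem monodromyCoeff_eq_zero_of_phase {r : ℝ} (hr : -P.e₃ < r) {n : ℕ}
    (hn : √(r + P.e₃) * √((r + P.e₁) * (r + P.e₂)) *
      ∫ x in (0 : ℝ)..P.T, (P.wpShift x + r)⁻¹ = n * Real.pi) :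
    P.monodromyCoeff r = 0 := by
  have h12 := P.e₂_lt_e₁
  have h23 := P.e₃_lt_e₂
  have ha : 0 < r + P.e₃ := by linarith
  have hb : 0 < (r + P.e₁) * (r + P.e₂) := mul_pos (by linarith) (by linarith)
  set α := √(r + P.e₃) with hα
  set β := √((r + P.e₁) * (r + P.e₂)) with hβ
  have hα2 : (α : ℂ) ^ 2 = P.coeffA r := by
    rw [coeffA]; exact_mod_cast Real.sq_sqrt ha.le
  have hβ2 : (β : ℂ) ^ 2 = P.coeffB r := by
    rw [coeffB]; exact_mod_cast Real.sq_sqrt hb.le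
  have hβ0 : (β : ℂ) ≠ 0 := ofReal_ne_zero.mpr (Real.sqrt_pos.mpr hb).ne'
  have hFpos : ∀ x, 0 < P.wpShift x + r := fun x => by linarith [(P.wpShift_mem_Icc' x).1]
  have hF0 : ∀ x, (P.wpShift x : ℂ) + r ≠ 0 := fun x => by exact_mod_cast (hFpos x).ne'
  have hcs := P.isLameSolution_cosSol r
  have hsn := P.isLameSolution_sinSol r
  set Zp : ℝ → ℂ := fun x => α * P.cosSol r x + I * β * P.sinSol r x with hZp
  set Zm : ℝ → ℂ := fun x => α * P.cosSol r x + (-I * β) * P.sinSol r x with hZm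
  have dZp := (hcs.lin hsn α (I * β)).1
  have dZm := (hcs.lin hsn α (-I * β)).1
  have hprod : ∀ x, Zp x * Zm x = P.wpShift x + r := fun x => by
    rw [wpShift_add_eq, ← hα2, ← hβ2]
    simp only [hZp, hZm]
    linear_combination -(β : ℂ) ^ 2 * P.sinSol r x ^ 2 * I_sq
  have hZm0 : ∀ x, Zm x ≠ 0 := fun x h => hF0 x (by rw [← hprod, h, mul_zero])
  have hinv : Continuous fun x => (P.wpShift x + r)⁻¹ :=
    (P.continuous_wpShift.add continuous_const).inv₀ fun x => (hFpos x).ne'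
  set Θ : ℝ → ℝ := fun x => α * β * ∫ s in (0 : ℝ)..x, (P.wpShift s + r)⁻¹ with hΘ
  have dΘ : ∀ x, HasDerivAt Θ (α * β * (P.wpShift x + r)⁻¹) x := fun x =>
    (intervalIntegral.integral_hasDerivAt_right (hinv.intervalIntegrable _ _)
      (hinv.stronglyMeasurableAtFilter _ _) hinv.continuousAt).const_mul _
  have dE : ∀ x, HasDerivAt (fun x => Complex.exp (-2 * I * Θ x))
      (Complex.exp (-2 * I * Θ x) * (-2 * I * (α * β * (P.wpShift x + r : ℂ)⁻¹))) x := fun x =>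
    (((dΘ x).ofReal_comp.const_mul (-2 * I)).cexp).congr_deriv (by push_cast; rfl)
  have dH : ∀ x, HasDerivAt (fun x => Zp x * Complex.exp (-2 * I * Θ x) / Zm x) 0 x := by
    intro x
    refine (((dZp x).mul (dE x)).div (dZm x) (hZm0 x)).congr_deriv ?_
    have h1 := hprod x
    have h3 : Zp x ≠ 0 := fun h => hF0 x (by rw [← hprod, h, zero_mul])
    have h4 := hZm0 x
    have h5 : (α * P.cosSol' r x + I * β * P.sinSol' r x) * Zm x -
        Zp x * (α * P.cosSol' r x + (-I * β) * P.sinSol' r x) = 2 * I * α * β := by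
      simp only [hZp, hZm]
      linear_combination 2 * I * α * β * P.wronskian_eq_one r x
    have h6 : (Zp x * Zm x)⁻¹ * (Zp x * Zm x) = 1 :=
      inv_mul_cancel₀ (mul_ne_zero h3 h4)
    rw [div_eq_zero_iff]
    left
    simp only [Pi.mul_apply]
    rw [← h1]
    linear_combination Complex.exp (-2 * I * Θ x) * h5 -
      Complex.exp (-2 * I * Θ x) * (2 * I * α * β) * h6
  have hconst := is_const_of_deriv_eq_zero (fun x => (dH x).differentiableAt)
    (fun x => (dH x).deriv) P.T 0
  have hΘT : Θ P.T = n * Real.pi := hn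
  have hexp : Complex.exp (-2 * I * ((n * Real.pi : ℝ) : ℂ)) = 1 := by
    rw [Complex.exp_eq_one_iff]
    exact ⟨-n, by push_cast; ring⟩
  have hΘ0 : Θ 0 = 0 := by simp [hΘ]
  have hα0 : (α : ℂ) ≠ 0 := ofReal_ne_zero.mpr (Real.sqrt_pos.mpr ha).ne'
  have e0 : Zp 0 = α := by simp [hZp]
  have e1 : Zm 0 = α := by simp [hZm]
  simp only [hΘT, hexp, hΘ0, e0, e1, ofReal_zero, mul_zero, Complex.exp_zero, mul_one,
    div_self hα0] at hconst
  rw [div_eq_one_iff_eq (hZm0 _)] at hconst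
  simp only [hZp, hZm] at hconst
  have h5 : (2 * I * β) * P.sinSol r P.T = 0 := by linear_combination hconst
  have h6 := (mul_eq_zero.mp h5).resolve_left
    (mul_ne_zero (mul_ne_zero two_ne_zero I_ne_zero) hβ0)
  rw [sinSol_T] at h6
  refine (mul_eq_zero.mp h6).resolve_left ?_
  rw [← hα2]
  exact pow_ne_zero 2 hα0

/-- The total phase is continuous and unbounded in the spectral parameter, so it takes all large
multiples of `π`. -/
theorem infinite_monodromyCoeff_eq_zero : {r : ℝ | P.monodromyCoeff r = 0}.Infinite := by
  have h12 := P.e₂_lt_e₁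
  have h23 := P.e₃_lt_e₂
  have hpi := Real.pi_pos
  -- the total phase, at the spectral parameter `1 + s ^ 2 - e₃`
  set p : ℝ → ℝ := fun s => √(1 + s ^ 2 - P.e₃ + P.e₃) *
    √((1 + s ^ 2 - P.e₃ + P.e₁) * (1 + s ^ 2 - P.e₃ + P.e₂)) *
    ∫ x in (0 : ℝ)..P.T, (P.wpShift x + (1 + s ^ 2 - P.e₃))⁻¹ with hp
  have hF : ∀ s x : ℝ, 0 < P.wpShift x + (1 + s ^ 2 - P.e₃) := fun s x => by
    linarith [(P.wpShift_mem_Icc' x).1, sq_nonneg s]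
  have hc : Continuous p := by
    have hi : Continuous fun s : ℝ => ∫ x in (0 : ℝ)..P.T,
        (P.wpShift x + (1 + s ^ 2 - P.e₃))⁻¹ := by
      refine intervalIntegral.continuous_parametric_intervalIntegral_of_continuous'
        (f := fun (s x : ℝ) => (P.wpShift x + (1 + s ^ 2 - P.e₃))⁻¹) ?_ 0 P.T
      have := P.continuous_wpShift
      exact Continuous.inv₀ (by fun_prop) fun z => (hF z.1 z.2).ne'
    fun_prop
  set D := 1 + (P.e₂ - P.e₃) with hD
  have hD0 : 0 < D := by linarith
  have hbound : ∀ s, 0 ≤ s → P.T / D * s ≤ p s := by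
    intro s hs
    have hk : 0 < 1 + s ^ 2 := by positivity
    have i1 : P.T * (D * (1 + s ^ 2))⁻¹ ≤
        ∫ x in (0 : ℝ)..P.T, (P.wpShift x + (1 + s ^ 2 - P.e₃))⁻¹ := by
      have := P.continuous_wpShift
      have hcont : Continuous fun x => (P.wpShift x + (1 + s ^ 2 - P.e₃))⁻¹ :=
        Continuous.inv₀ (by fun_prop) fun x => (hF s x).ne'
      have hle := intervalIntegral.integral_mono_on (μ := MeasureTheory.volume)
        (f := fun _ => (D * (1 + s ^ 2))⁻¹)
        P.T_pos.le (continuous_const.intervalIntegrable _ _) (hcont.intervalIntegrable _ _)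
        (fun x _ => by
          refine inv_anti₀ (hF s x) ?_
          nlinarith [(P.wpShift_mem_Icc' x).2, sq_nonneg s])
      simpa only [intervalIntegral.integral_const, smul_eq_mul, sub_zero] using hle
    have i2 : 1 + s ^ 2 ≤
        √((1 + s ^ 2 - P.e₃ + P.e₁) * (1 + s ^ 2 - P.e₃ + P.e₂)) := by
      refine Real.le_sqrt_of_sq_le ?_
      rw [sq (1 + s ^ 2)]
      exact mul_le_mul (by linarith) (by linarith) hk.le (by linarith)
    have i3 : s ≤ √(1 + s ^ 2 - P.e₃ + P.e₃) := Real.le_sqrt_of_sq_le (by linarith)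
    calc P.T / D * s = s * (1 + s ^ 2) * (P.T * (D * (1 + s ^ 2))⁻¹) := by
          field_simp
      _ ≤ p s := by
          refine mul_le_mul (mul_le_mul i3 i2 hk.le (Real.sqrt_nonneg _)) i1 ?_ (by positivity)
          have := P.T_pos
          positivity
  have hsol : ∀ n : ℕ, p 0 ≤ n * Real.pi → ∃ s, 0 ≤ s ∧ p s = n * Real.pi := by
    intro n hn
    have hT := P.T_pos
    obtain ⟨s, hs, hps⟩ := intermediate_value_Icc (a := 0) (b := D / P.T * (n * Real.pi))
      (by positivity) hc.continuousOn ⟨hn, by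
        refine le_trans (le_of_eq ?_) (hbound _ (by positivity))
        field_simp⟩
    exact ⟨s, hs.1, hps⟩
  obtain ⟨N, hN⟩ := exists_nat_ge (p 0 / Real.pi)
  have hN' : ∀ n : ℕ, p 0 ≤ (N + n : ℕ) * Real.pi := fun n => by
    rw [div_le_iff₀ hpi] at hN
    push_cast
    nlinarith [mul_nonneg n.cast_nonneg hpi.le]
  choose s hs0 hs using fun n => hsol (N + n) (hN' n)
  have hinj : Function.Injective fun n => 1 + s n ^ 2 - P.e₃ := by
    intro m n h
    have h1 : s m = s n := by
      rw [← sq_eq_sq₀ (hs0 m) (hs0 n)]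
      simp only at h
      linarith
    have h2 := (hs m).symm.trans ((congrArg p h1).trans (hs n))
    have h3 := mul_right_cancel₀ hpi.ne' h2
    have h4 : N + m = N + n := by exact_mod_cast h3
    omega
  refine Set.infinite_of_injective_forall_mem hinj fun n => ?_
  refine P.monodromyCoeff_eq_zero_of_phase (n := N + n) ?_ (hs n)
  linarith [sq_nonneg (s n)]

/-- The Dirichlet eigenvalues of the regular operator are isolated: solutions for different
eigenvalues are orthogonal, while they are continuous in the eigenvalue. -/
theorem eventually_sinR_T_ne_zero {r : ℝ} (hr : P.sinR r P.T = 0) :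
    ∀ᶠ v in 𝓝[≠] r, P.sinR v P.T ≠ 0 := by
  have hs := P.isRealSolution_sinR
  have hc : Continuous fun v : ℝ => ∫ x in (0 : ℝ)..P.T, P.sinR v x * P.sinR r x := by
    refine intervalIntegral.continuous_parametric_intervalIntegral_of_continuous'
      (f := fun v x => P.sinR v x * P.sinR r x) ?_ 0 P.T
    have h1 : Continuous fun z : ℝ × ℝ => P.sinR z.1 z.2 :=
      continuous_re.comp (P.continuous_sinSol.comp
        ((continuous_ofReal.comp continuous_fst).prodMk continuous_snd))
    exact h1.mul ((hs r).continuous.comp continuous_snd)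
  have hpos : 0 < ∫ x in (0 : ℝ)..P.T, P.sinR r x * P.sinR r x := by
    obtain ⟨c, hc, hc0⟩ := P.exists_sinSol_ne_zero r
    rw [← (P.ofReal_sinR r c).1, ofReal_ne_zero] at hc0
    exact intervalIntegral.integral_pos P.T_pos
      ((hs r).continuous.mul (hs r).continuous).continuousOn (fun x _ => mul_self_nonneg _)
      ⟨c, ⟨hc.1.le, hc.2.le⟩, mul_self_pos.mpr hc0⟩
  filter_upwards [(hc.tendsto r).mono_left nhdsWithin_le_nhds |>.eventually (lt_mem_nhds hpos),
    self_mem_nhdsWithin] with v hv hvr h0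
  have hW := (hs v).mul_integral (hs r) 0 P.T
  rw [h0, hr, sinR_zero, sinR_zero] at hW
  simp only [zero_mul, mul_zero, sub_self] at hW
  exact mul_ne_zero (sub_ne_zero.mpr hvr) hv.ne' hW

theorem finite_sinR_T_eq_zero (a b : ℝ) : {r ∈ Set.Icc a b | P.sinR r P.T = 0}.Finite := by
  by_contra hinf
  obtain ⟨z, -, hz⟩ := Set.Infinite.exists_accPt_of_subset_isCompact hinf isCompact_Icc
    (Set.sep_subset _ _)
  have h1 : ∃ᶠ v in 𝓝[≠] z, P.sinR v P.T = 0 :=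
    (accPt_iff_frequently_nhdsNE.mp hz).mono fun v hv => hv.2
  have hclosed : IsClosed {v : ℝ | P.sinR v P.T = 0} :=
    isClosed_eq (continuous_re.comp (P.continuous_sinSol.comp
      (continuous_ofReal.prodMk continuous_const))) continuous_const
  have hz0 : P.sinR z P.T = 0 :=
    hclosed.mem_of_frequently_of_tendsto h1 (tendsto_id.mono_left nhdsWithin_le_nhds)
  exact h1 (P.eventually_sinR_T_ne_zero hz0)

/-- An infinite set of reals, bounded below and locally finite, is the range of a strictly
increasing sequence. -/
theorem exists_strictMono_range_eq {A : Set ℝ} (hA : A.Infinite) {m : ℝ} (hm : ∀ x ∈ A, m ≤ x)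
    (hfin : ∀ b, (A ∩ Set.Icc m b).Finite) :
    ∃ lam : ℕ → ℝ, StrictMono lam ∧ Set.range lam = A := by
  -- the sequence is obtained by iterating the map to the next larger element
  have hcof : ∀ b, ∃ x ∈ A, b < x := by
    intro b
    by_contra! h
    exact hA ((hfin b).subset fun x hx => ⟨hx, hm x hx, h x hx⟩)
  have hleast : ∀ b, ∃ x, IsLeast (A ∩ Set.Ioi b) x := by
    intro b
    obtain ⟨x, hx, hbx⟩ := hcof b
    obtain ⟨z, hz, hmin⟩ := Set.exists_min_image (A ∩ Set.Icc m x ∩ Set.Ioi b) id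
      ((hfin x).subset Set.inter_subset_left) ⟨x, ⟨hx, hm x hx, le_rfl⟩, hbx⟩
    refine ⟨z, ⟨hz.1.1, hz.2⟩, fun w hw => ?_⟩
    rcases le_total w x with h | h
    · exact hmin w ⟨⟨hw.1, hm w hw.1, h⟩, hw.2⟩
    · exact hz.1.2.2.trans h
  choose f hf using hleast
  let lam : ℕ → ℝ := fun n => f^[n] (f (m - 1))
  have hsucc : ∀ n, lam (n + 1) = f (lam n) := fun n => Function.iterate_succ_apply' f n _
  have hmono : StrictMono lam := strictMono_nat_of_lt_succ fun n => by
    rw [hsucc]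
    exact (hf _).1.2
  have hmem : ∀ n, lam n ∈ A := by
    intro n
    cases n with
    | zero => exact (hf _).1.1
    | succ n => rw [hsucc]; exact (hf _).1.1
  refine ⟨lam, hmono, Set.Subset.antisymm (Set.range_subset_iff.mpr hmem) fun x hx => ?_⟩
  by_contra hxr
  have hlt : ∀ n, lam n < x := by
    intro n
    refine lt_of_le_of_ne ?_ fun h => hxr ⟨n, h⟩
    induction n with
    | zero => exact (hf _).2 ⟨hx, by simp only [Set.mem_Ioi]; linarith [hm x hx]⟩
    | succ n ih =>
      rw [hsucc]
      exact (hf _).2 ⟨hx, lt_of_le_of_ne ih fun h => hxr ⟨n, h⟩⟩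
  exact Set.infinite_of_injective_forall_mem hmono.injective
    (fun n => (⟨hmem n, hm _ (hmem n), (hlt n).le⟩ : lam n ∈ A ∩ Set.Icc m x)) (hfin x)

theorem exists_sequence : ∃ lam : ℕ → ℝ, StrictMono lam ∧
    {u : ℂ | P.monodromyCoeff u = 0} = Set.range (fun s => (lam s : ℂ)) ∧
    ∀ s, -P.e₃ < lam s := by
  have hgt : ∀ r : ℝ, P.monodromyCoeff r = 0 → -P.e₃ < r := by
    intro r hr
    obtain ⟨r', h1, h2⟩ := P.exists_real_of_monodromyCoeff_eq_zero hr
    rwa [ofReal_inj.mp h1]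
  obtain ⟨lam, hmono, hrange⟩ := exists_strictMono_range_eq P.infinite_monodromyCoeff_eq_zero
    (m := -P.e₃) (fun r hr => (hgt r hr).le) fun b => by
      refine (P.finite_sinR_T_eq_zero (-P.e₃) b).subset fun r hr => ⟨hr.2, ?_⟩
      have h : P.monodromyCoeff r = 0 := hr.1
      rw [sinR, sinSol_T, h, mul_zero, zero_re]
  have hmem : ∀ r : ℝ, P.monodromyCoeff r = 0 ↔ r ∈ Set.range lam := fun r => by
    rw [hrange]
    rfl
  refine ⟨lam, hmono, ?_, fun s => hgt _ ((hmem _).mpr ⟨s, rfl⟩)⟩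
  ext u
  constructor
  · intro hu
    obtain ⟨r, rfl, -⟩ := P.exists_real_of_monodromyCoeff_eq_zero hu
    obtain ⟨s, hs⟩ := (hmem r).mp hu
    exact ⟨s, congrArg _ hs⟩
  · rintro ⟨s, rfl⟩
    exact (hmem _).mpr ⟨s, rfl⟩

/-! ### The singular operator as a Darboux transform of the regular one -/

theorem lamePotential_zero (x : ℝ) : P.lamePotential 0 x = 2 * P.wpReal x := by
  rw [lamePotential, add_zero, weierstrassP_ofReal]

/-- The Dirichlet ground state of the regular operator. -/
def groundState (x : ℝ) : ℂ := P.sinSol (-P.e₃ : ℝ) x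

/-- The derivative of `groundState`. -/
def groundState' (x : ℝ) : ℂ := P.sinSol' (-P.e₃ : ℝ) x

theorem isLameSolution_groundState :
    P.IsLameSolution (-P.e₃ : ℝ) P.groundState P.groundState' := P.isLameSolution_sinSol _

@[simp] theorem groundState_zero : P.groundState 0 = 0 := P.sinSol_zero _

@[simp] theorem groundState'_zero : P.groundState' 0 = 1 := P.sinSol'_zero _

@[simp] theorem groundState_T : P.groundState P.T = 0 := by
  rw [groundState, ← (P.ofReal_sinR _ _).1, sinR_e₃_T, ofReal_zero]

theorem groundState'_T_ne_zero : P.groundState' P.T ≠ 0 := by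
  intro h
  have h1 := P.wronskian_eq_one (-P.e₃ : ℝ) P.T
  change _ * P.groundState' P.T - _ * P.groundState P.T = 1 at h1
  rw [h, groundState_T] at h1
  simp at h1

theorem groundState_ne_zero {x : ℝ} (hx : x ∈ Set.Ioo 0 P.T) : P.groundState x ≠ 0 := by
  rw [groundState, ← (P.ofReal_sinR _ _).1, ofReal_ne_zero]
  exact (P.sinR_pos hx).ne'

/-- The potential of the singular operator in terms of the logarithmic derivative `χ' / χ` of the
ground state `χ` of the regular operator. -/
theorem groundState'_sq {x : ℝ} (hx : x ∈ Set.Ioo 0 P.T) :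
    P.groundState' x ^ 2 = (P.wpReal x + P.wpShift x + P.e₃) * P.groundState x ^ 2 := by
  have hreal : P.sinR' (-P.e₃) x ^ 2 =
      (P.wpReal x + P.wpShift x + P.e₃) * P.sinR (-P.e₃) x ^ 2 := by
    have hχ := P.isRealSolution_sinR (-P.e₃)
    have h1 := P.wpShift_sub_e₃ x
    have h2 : P.wpShift' x = (P.e₃ - P.e₁) * (P.e₃ - P.e₂) *
        (2 * P.sinR (-P.e₃) x * P.sinR' (-P.e₃) x) := by
      have hd := ((hχ.1 x).pow 2).const_mul ((P.e₃ - P.e₁) * (P.e₃ - P.e₂))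
      refine ((P.hasDerivAt_wpShift x).sub_const P.e₃).unique
        ((hd.congr_of_eventuallyEq (.of_forall P.wpShift_sub_e₃)).congr_deriv ?_)
      norm_num
    have h3 := P.wpShift'_sq x
    have h4 := P.wpShift_sub_mul_wpReal_sub hx
    have hb := P.prod_pos.ne'
    have hf := (sub_pos.mpr (P.e₃_lt_wpShift hx)).ne'
    set b := (P.e₃ - P.e₁) * (P.e₃ - P.e₂) with hbdef
    have h5 : b * P.sinR' (-P.e₃) x ^ 2 = (P.wpShift x - P.e₁) * (P.wpShift x - P.e₂) := by
      refine mul_left_cancel₀ hf ?_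
      rw [h2] at h3
      have : P.wpShift x - P.e₃ = b * P.sinR (-P.e₃) x ^ 2 := h1
      linear_combination b * P.sinR' (-P.e₃) x ^ 2 * this + (1 / 4) * h3
    refine mul_left_cancel₀ hb ?_
    rw [h5]
    have e : b * ((P.wpReal x + P.wpShift x + P.e₃) * P.sinR (-P.e₃) x ^ 2) =
        (P.wpReal x + P.wpShift x + P.e₃) * (P.wpShift x - P.e₃) := by rw [h1]; ring
    rw [e]
    have e2 := P.e₂_eq
    rw [hbdef] at h4
    rw [e2] at h4 ⊢
    linear_combination -h4
  rw [groundState, groundState', ← (P.ofReal_sinR _ _).1, ← (P.ofReal_sinR _ _).2]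
  exact_mod_cast hreal

/-- The logarithmic derivative of the ground state. -/
def logDerivGround (x : ℝ) : ℂ := P.groundState' x / P.groundState x

theorem logDerivGround_sq {x : ℝ} (hx : x ∈ Set.Ioo 0 P.T) :
    P.logDerivGround x ^ 2 = P.wpReal x + P.wpShift x + P.e₃ := by
  rw [logDerivGround, div_pow, groundState'_sq P hx,
    mul_div_cancel_right₀ _ (pow_ne_zero 2 (P.groundState_ne_zero hx))]

/-- The Riccati equation of the logarithmic derivative of the ground state. -/
theorem hasDerivAt_logDerivGround {x : ℝ} (hx : x ∈ Set.Ioo 0 P.T) :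
    HasDerivAt P.logDerivGround (P.wpShift x - P.wpReal x) x := by
  have h := P.isLameSolution_groundState
  have h0 := P.groundState_ne_zero hx
  refine ((h.2 x).div (h.1 x) h0).congr_deriv ?_
  have h1 := P.groundState'_sq hx
  rw [div_eq_iff (pow_ne_zero 2 h0)]
  push_cast
  linear_combination -h1

theorem hasDerivAt_of_mem_hermitEigenspace {u : ℂ} {ψ : ℝ → ℂ} (hψ : ψ ∈ P.hermitEigenspace u)
    {x : ℝ} (hx : x ∈ Set.Ioo 0 P.T) : HasDerivAt ψ (deriv ψ x) x ∧
      HasDerivAt (deriv ψ) ((2 * P.wpReal x - u) * ψ x) x := by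
  obtain ⟨-, -, h3, h4⟩ := hψ
  have hopen : Set.Ioo 0 P.T ∈ 𝓝 x := isOpen_Ioo.mem_nhds hx
  refine ⟨((h3.differentiableOn (by norm_num)).differentiableAt hopen).hasDerivAt, ?_⟩
  refine (((h3.deriv_of_isOpen (m := 1) isOpen_Ioo (by norm_num)).differentiableOn
    (by norm_num)).differentiableAt hopen).hasDerivAt.congr_deriv ?_
  have := h4 x hx
  rw [schrodinger, lamePotential_zero] at this
  linear_combination -this

/-- The Darboux transform `ψ' + (χ' / χ) ψ` of an eigenfunction `ψ` of the singular operator is a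
solution of the regular equation, and determines `ψ` unless `u = u₂`. It vanishes at both ends since
`ψ` is bounded there. -/
theorem exists_darboux {u : ℂ} {ψ : ℝ → ℂ} (hψ : ψ ∈ P.hermitEigenspace u) :
    ∃ β : ℂ, β * P.sinSol u P.T = 0 ∧ ∀ x ∈ Set.Ioo 0 P.T,
      deriv ψ x + P.logDerivGround x * ψ x = β * P.sinSol u x ∧
      (u + P.e₃) * (ψ x * P.groundState x) =
        β * (P.groundState' x * P.sinSol u x - P.groundState x * P.sinSol' u x) := by
  have hd := fun x (hx : x ∈ Set.Ioo 0 P.T) => P.hasDerivAt_of_mem_hermitEigenspace hψ hx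
  set h := P.logDerivGround with hh
  have dh := fun x (hx : x ∈ Set.Ioo 0 P.T) => P.hasDerivAt_logDerivGround hx
  have hsq := fun x (hx : x ∈ Set.Ioo 0 P.T) => P.logDerivGround_sq hx
  set G : ℝ → ℂ := fun x => deriv ψ x + h x * ψ x with hG
  set G' : ℝ → ℂ := fun x => h x * G x - (u + P.e₃) * ψ x with hG'
  have dG : ∀ x ∈ Set.Ioo 0 P.T, HasDerivAt G (G' x) x := by
    intro x hx
    refine ((hd x hx).2.add ((dh x hx).mul (hd x hx).1)).congr_deriv ?_
    have := hsq x hx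
    simp only [hG', hG, hh]
    linear_combination -ψ x * this
  have dG' : ∀ x ∈ Set.Ioo 0 P.T, HasDerivAt G' ((2 * P.wpShift x - u) * G x) x := by
    intro x hx
    refine (((dh x hx).mul (dG x hx)).sub ((hd x hx).1.const_mul (u + P.e₃))).congr_deriv ?_
    have := hsq x hx
    simp only [hG', hG, hh] at this ⊢
    linear_combination (deriv ψ x + P.logDerivGround x * ψ x) * this
  -- the regular solution with the data of `G` at the midpoint
  set α := G (P.T / 2) * P.sinSol' u (P.T / 2) - G' (P.T / 2) * P.sinSol u (P.T / 2) with hα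
  set β := G' (P.T / 2) * P.cosSol u (P.T / 2) - G (P.T / 2) * P.cosSol' u (P.T / 2) with hβ
  have hg := (P.isLameSolution_cosSol u).lin (P.isLameSolution_sinSol u) α β
  have hw := P.wronskian_eq_one u (P.T / 2)
  have heq := eq_zero_of_hasDerivAt_mul (𝕜 := ℂ) (x₀ := P.T / 2)
    (f := fun x => G x - (α * P.cosSol u x + β * P.sinSol u x))
    (f' := fun x => G' x - (α * P.cosSol' u x + β * P.sinSol' u x))
    (P.continuous_coeff u).continuousOn P.half_mem_Ioo
    (fun x hx => (dG x hx).sub (hg.1 x))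
    (fun x hx => ((dG' x hx).sub (hg.2 x)).congr_deriv (by ring))
    (by simp only [hα, hβ]; linear_combination -G (P.T / 2) * hw)
    (by simp only [hα, hβ]; linear_combination -G' (P.T / 2) * hw)
  have hkey : Set.EqOn (fun x => (u + P.e₃) * (ψ x * P.groundState x))
      (fun x => P.groundState' x * (α * P.cosSol u x + β * P.sinSol u x) -
        P.groundState x * (α * P.cosSol' u x + β * P.sinSol' u x)) (Set.Ioo 0 P.T) := by
    intro x hx
    obtain ⟨h1, h2⟩ := heq x hx
    have h0 := P.groundState_ne_zero hx
    have h3 : P.groundState x * h x = P.groundState' x := by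
      rw [hh, logDerivGround]
      field_simp
    simp only [hG'] at h2
    simp only
    linear_combination -P.groundState x * h2 + P.groundState' x * h1 + G x * h3
  have hgs := P.isLameSolution_groundState
  have hkey' := hkey.of_subset_closure (t := Set.Icc 0 P.T)
    (continuousOn_const.mul (hψ.2.1.mul hgs.continuous.continuousOn))
    ((hgs.continuous'.mul hg.continuous).sub (hgs.continuous.mul hg.continuous')).continuousOn
    Set.Ioo_subset_Icc_self (by rw [closure_Ioo P.T_pos.ne])
  -- at `0` the left-hand side vanishes, while `χ(0) = 0`, `χ'(0) = 1`
  have hα0 : α = 0 := by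
    have := hkey' ⟨le_rfl, P.T_pos.le⟩
    simpa using this.symm
  refine ⟨β, ?_, fun x hx => ⟨?_, ?_⟩⟩
  · have := hkey' ⟨P.T_pos.le, le_rfl⟩
    simp only [groundState_T, mul_zero, hα0, zero_mul, zero_add, sub_zero] at this
    exact (mul_eq_zero.mp this.symm).resolve_left P.groundState'_T_ne_zero
  · have := (heq x hx).1
    rw [hα0] at this
    linear_combination this
  · have := hkey hx
    simp only [hα0] at this
    linear_combination this

/-- There is no eigenfunction at `u₂`: the equation `ψ' + (χ' / χ) ψ = β χ` integrates to
`χ ψ = β ∫ χ²`, which vanishes at `T` only for `β = 0`. -/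
theorem hermitEigenspace_e₃ : P.hermitEigenspace (-P.e₃ : ℝ) = ⊥ := by
  rw [Submodule.eq_bot_iff]
  intro ψ hψ
  obtain ⟨β, -, hβ⟩ := P.exists_darboux hψ
  have hgs := P.isLameSolution_groundState
  set f : ℝ → ℂ := fun x => P.groundState x * ψ x with hf
  have hfc : ContinuousOn f (Set.Icc 0 P.T) := hgs.continuous.continuousOn.mul hψ.2.1
  have df : ∀ x ∈ Set.Ioo 0 P.T, HasDerivAt f (β * P.groundState x ^ 2) x := by
    intro x hx
    refine ((hgs.1 x).mul (P.hasDerivAt_of_mem_hermitEigenspace hψ hx).1).congr_deriv ?_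
    have h1 := (hβ x hx).1
    have h0 := P.groundState_ne_zero hx
    have h3 : P.groundState x * P.logDerivGround x = P.groundState' x := by
      rw [logDerivGround]
      field_simp
    change _ = β * P.groundState x at h1
    linear_combination P.groundState x * h1 - ψ x * h3
  have hint : ∀ z ∈ Set.Icc 0 P.T, β * ∫ x in (0 : ℝ)..z, P.groundState x ^ 2 = f z := by
    intro z hz
    have := intervalIntegral.integral_eq_sub_of_hasDerivAt_of_le hz.1
      (hfc.mono (Set.Icc_subset_Icc_right hz.2))
      (fun x hx => df x ⟨hx.1, hx.2.trans_le hz.2⟩)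
      ((continuous_const.mul (hgs.continuous.pow 2)).intervalIntegrable _ _)
    rw [← intervalIntegral.integral_const_mul, this]
    simp [hf]
  have hpos : (∫ x in (0 : ℝ)..P.T, P.groundState x ^ 2) ≠ 0 := by
    have e : ∀ x, P.groundState x ^ 2 = ((P.sinR (-P.e₃) x ^ 2 : ℝ) : ℂ) := fun x => by
      rw [groundState, ← (P.ofReal_sinR _ _).1, ofReal_pow]
    simp only [e]
    rw [intervalIntegral.integral_ofReal, ofReal_ne_zero]
    have hc := (P.isRealSolution_sinR (-P.e₃)).continuous.pow 2
    exact (intervalIntegral.intervalIntegral_pos_of_pos_on (hc.intervalIntegrable _ _)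
      (fun x hx => pow_pos (P.sinR_pos hx) 2) P.T_pos).ne'
  have hβ0 : β = 0 := by
    have h := hint P.T ⟨P.T_pos.le, le_rfl⟩
    rw [hf] at h
    simp only [groundState_T, zero_mul] at h
    exact (mul_eq_zero.mp h).resolve_right hpos
  funext x
  by_cases hx : x ∈ Set.Ioo 0 P.T
  · have h := hint x ⟨hx.1.le, hx.2.le⟩
    rw [hβ0, zero_mul] at h
    exact (mul_eq_zero.mp h.symm).resolve_left (P.groundState_ne_zero hx)
  · exact hψ.1 x hx

open Classical in
/-- The inverse Darboux transform `(χ' φ - χ φ') / χ` of `φ = sinSol u`, extended by zero. -/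
def hermitSol (u : ℂ) (x : ℝ) : ℂ :=
  if x ∈ Set.Ioo 0 P.T then
    (P.sinSol u x * P.groundState' x - P.sinSol' u x * P.groundState x) / P.groundState x
  else 0

theorem tendsto_div_of_hasDerivAt_zero {f g : ℝ → ℂ} {d : ℂ} {a : ℝ} (hf : HasDerivAt f 0 a)
    (hg : HasDerivAt g d a) (hd : d ≠ 0) (hf0 : f a = 0) (hg0 : g a = 0) :
    Tendsto (fun x => f x / g x) (𝓝[≠] a) (𝓝 0) := by
  have h := (hasDerivAt_iff_tendsto_slope.mp hf).div (hasDerivAt_iff_tendsto_slope.mp hg) hd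
  rw [zero_div] at h
  refine h.congr' ?_
  filter_upwards [self_mem_nhdsWithin] with x hx
  have hne : ((x - a : ℝ) : ℂ) ≠ 0 := ofReal_ne_zero.mpr (sub_ne_zero.mpr hx)
  simp only [Pi.div_apply, slope_def_module, hf0, hg0, sub_zero, Complex.real_smul, ofReal_inv]
  rw [mul_div_mul_left _ _ (inv_ne_zero hne)]

theorem contDiffOn_two_of_hasDerivAt {f f' f'' : ℝ → ℂ} {s : Set ℝ} (hs : IsOpen s)
    (h1 : ∀ x ∈ s, HasDerivAt f (f' x) x) (h2 : ∀ x ∈ s, HasDerivAt f' (f'' x) x)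
    (h3 : ContinuousOn f'' s) : ContDiffOn ℝ 2 f s := by
  have e1 : Set.EqOn (deriv f) f' s := fun x hx => (h1 x hx).deriv
  have e2 : Set.EqOn (deriv f') f'' s := fun x hx => (h2 x hx).deriv
  rw [show (2 : WithTop ℕ∞) = 1 + 1 from one_add_one_eq_two.symm,
    contDiffOn_succ_iff_deriv_of_isOpen hs]
  refine ⟨fun x hx => (h1 x hx).differentiableAt.differentiableWithinAt, by simp, ?_⟩
  refine ContDiffOn.congr ?_ e1
  rw [show (1 : WithTop ℕ∞) = 0 + 1 from (zero_add 1).symm,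
    contDiffOn_succ_iff_deriv_of_isOpen hs]
  refine ⟨fun x hx => (h2 x hx).differentiableAt.differentiableWithinAt, by simp, ?_⟩
  rw [contDiffOn_zero]
  exact h3.congr e2

theorem hermitSol_mem {u : ℂ} (hT : P.sinSol u P.T = 0) :
    P.hermitSol u ∈ P.hermitEigenspace u := by
  have hgs := P.isLameSolution_groundState
  have hφ := P.isLameSolution_sinSol u
  set N : ℝ → ℂ := fun x => P.sinSol u x * P.groundState' x - P.sinSol' u x * P.groundState x
    with hN
  have dN : ∀ x, HasDerivAt N ((u - (-P.e₃ : ℝ)) * (P.sinSol u x * P.groundState x)) x :=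
    hφ.hasDerivAt_wronskian hgs
  have heq : ∀ x ∈ Set.Ioo 0 P.T, P.hermitSol u x = N x / P.groundState x := fun x hx => by
    rw [hermitSol, if_pos hx]
  have hev : ∀ x ∈ Set.Ioo 0 P.T, P.hermitSol u =ᶠ[𝓝 x] fun x => N x / P.groundState x :=
    fun x hx => by
      filter_upwards [isOpen_Ioo.mem_nhds hx] with z hz using heq z hz
  set f' : ℝ → ℂ := fun x => (u + P.e₃) * P.sinSol u x - P.logDerivGround x * P.hermitSol u x
    with hf'
  have d1 : ∀ x ∈ Set.Ioo 0 P.T, HasDerivAt (P.hermitSol u) (f' x) x := by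
    intro x hx
    have h0 := P.groundState_ne_zero hx
    refine (((dN x).div (hgs.1 x) h0).congr_deriv ?_).congr_of_eventuallyEq (hev x hx)
    simp only [hf', heq x hx, logDerivGround]
    push_cast
    field_simp
    ring
  have d2 : ∀ x ∈ Set.Ioo 0 P.T, HasDerivAt f' ((2 * P.wpReal x - u) * P.hermitSol u x) x := by
    intro x hx
    have h0 := P.groundState_ne_zero hx
    refine (((hφ.1 x).const_mul (u + P.e₃)).sub
      ((P.hasDerivAt_logDerivGround hx).mul (d1 x hx))).congr_deriv ?_
    have h1 := P.logDerivGround_sq hx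
    have h2 : P.hermitSol u x = P.logDerivGround x * P.sinSol u x - P.sinSol' u x := by
      rw [heq x hx, logDerivGround, hN]
      field_simp
    simp only [hf']
    linear_combination (u + P.e₃) * h2 + P.hermitSol u x * h1
  have dfc : ContinuousOn (P.hermitSol u) (Set.Ioo 0 P.T) := fun x hx =>
    (d1 x hx).continuousAt.continuousWithinAt
  have hout : ∀ x ∉ Set.Ioo 0 P.T, P.hermitSol u x = 0 := fun x hx => by
    rw [hermitSol, if_neg hx]
  have hend : ∀ a, P.sinSol u a = 0 → P.groundState a = 0 → P.groundState' a ≠ 0 →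
      a ∉ Set.Ioo 0 P.T → ContinuousAt (P.hermitSol u) a := by
    intro a h1 h2 h3 h4
    rw [continuousAt_iff_punctured_nhds, hout a h4]
    have hdN : HasDerivAt N 0 a := (dN a).congr_deriv (by rw [h1]; ring)
    have hN0 : N a = 0 := by simp [hN, h1, h2]
    refine squeeze_zero_norm (fun x => ?_)
      (by simpa using (tendsto_div_of_hasDerivAt_zero hdN (hgs.1 a) h3 hN0 h2).norm)
    by_cases hx : x ∈ Set.Ioo 0 P.T
    · rw [heq x hx, norm_div]
    · rw [hout x hx, norm_zero]
      positivity
  refine ⟨hout, fun x hx => ?_, ?_, fun x hx => ?_⟩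
  · rcases hx.1.eq_or_lt with h | h
    · subst h
      exact (hend 0 (by simp) (by simp) (by simp) (by simp)).continuousWithinAt
    rcases hx.2.eq_or_lt with h' | h'
    · subst h'
      exact (hend P.T hT (by simp) P.groundState'_T_ne_zero (by simp)).continuousWithinAt
    exact (d1 x ⟨h, h'⟩).continuousAt.continuousWithinAt
  · refine contDiffOn_two_of_hasDerivAt isOpen_Ioo d1 d2 ?_
    have := P.continuousOn_wpReal
    exact ((continuousOn_const.mul (continuous_ofReal.comp_continuousOn this)).sub
      continuousOn_const).mul dfc
  · have e : deriv (P.hermitSol u) =ᶠ[𝓝 x] f' := by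
      filter_upwards [isOpen_Ioo.mem_nhds hx] with z hz using (d1 z hz).deriv
    rw [schrodinger, e.deriv_eq, (d2 x hx).deriv, lamePotential_zero]
    ring

theorem hermitSol_ne_zero {u : ℂ} (hu : u + P.e₃ ≠ 0) : P.hermitSol u ≠ 0 := by
  intro h
  obtain ⟨x, hx, hx0⟩ := P.exists_sinSol_ne_zero u
  have h0 := P.groundState_ne_zero hx
  have dN := (P.isLameSolution_sinSol u).hasDerivAt_wronskian P.isLameSolution_groundState x
  have hev : (fun x => P.sinSol u x * P.groundState' x - P.sinSol' u x * P.groundState x)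
      =ᶠ[𝓝 x] fun _ => 0 := by
    filter_upwards [isOpen_Ioo.mem_nhds hx] with z hz
    have := congrFun h z
    rw [hermitSol, if_pos hz] at this
    exact (div_eq_zero_iff.mp this).resolve_right (P.groundState_ne_zero hz)
  have := dN.unique ((hasDerivAt_const x (0 : ℂ)).congr_of_eventuallyEq hev)
  refine mul_ne_zero hu (mul_ne_zero hx0 h0) ?_
  rw [← this]
  push_cast
  ring

/-- Away from `u₂` every eigenspace is spanned by `hermitSol`, and is zero unless the regular
equation has a Dirichlet solution. -/
theorem exists_smul_hermitSol {u : ℂ} (hu : u + P.e₃ ≠ 0) {ψ : ℝ → ℂ}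
    (hψ : ψ ∈ P.hermitEigenspace u) : ∃ c : ℂ, c * P.sinSol u P.T = 0 ∧ ψ = c • P.hermitSol u := by
  obtain ⟨β, hT, hβ⟩ := P.exists_darboux hψ
  refine ⟨β / (u + P.e₃), by rw [div_mul_eq_mul_div, hT, zero_div], funext fun x => ?_⟩
  rw [Pi.smul_apply, smul_eq_mul, hermitSol]
  split_ifs with hx
  · have h0 := P.groundState_ne_zero hx
    have h1 := (hβ x hx).2
    field_simp
    linear_combination h1
  · rw [hψ.1 x hx, mul_zero]

theorem hermitSpectrum_eq : P.hermitSpectrum = {u | P.monodromyCoeff u = 0} := by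
  ext u
  simp only [hermitSpectrum, Set.mem_ofPred_eq]
  constructor
  · intro h
    have hu : u + P.e₃ ≠ 0 := by
      intro hu
      refine h ?_
      rw [eq_neg_of_add_eq_zero_left hu, ← ofReal_neg, hermitEigenspace_e₃]
    obtain ⟨ψ, hψ, h0⟩ := (Submodule.ne_bot_iff _).mp h
    obtain ⟨c, hc, rfl⟩ := P.exists_smul_hermitSol hu hψ
    have hc0 : c ≠ 0 := by
      rintro rfl
      simp at h0
    have := (mul_eq_zero.mp hc).resolve_left hc0
    rw [sinSol_T] at this
    exact (mul_eq_zero.mp this).resolve_left hu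
  · intro h
    obtain ⟨r, rfl, hr⟩ := P.exists_real_of_monodromyCoeff_eq_zero h
    have hu : (r : ℂ) + P.e₃ ≠ 0 := by
      norm_cast
      linarith
    rw [Submodule.ne_bot_iff]
    exact ⟨_, P.hermitSol_mem (by rw [sinSol_T, h, mul_zero]), P.hermitSol_ne_zero hu⟩

theorem finrank_hermitEigenspace {u : ℂ} (hu : u ∈ P.hermitSpectrum) :
    Module.finrank ℂ (P.hermitEigenspace u) = 1 := by
  rw [hermitSpectrum_eq] at hu
  have h : P.monodromyCoeff u = 0 := hu
  obtain ⟨r, rfl, hr⟩ := P.exists_real_of_monodromyCoeff_eq_zero h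
  have hu : (r : ℂ) + P.e₃ ≠ 0 := by
    norm_cast
    linarith
  have hmem := P.hermitSol_mem (u := r) (by rw [sinSol_T, h, mul_zero])
  rw [finrank_eq_one_iff_of_nonzero' (⟨_, hmem⟩ : P.hermitEigenspace r)
    (fun h0 => P.hermitSol_ne_zero hu (congrArg Subtype.val h0))]
  rintro ⟨ψ, hψ⟩
  obtain ⟨c, -, rfl⟩ := P.exists_smul_hermitSol hu hψ
  exact ⟨c, rfl⟩

theorem areBranchingPoints : P.AreBranchingPoints (-P.e₁) (-P.e₂) (-P.e₃) := by
  refine ⟨neg_lt_neg P.e₂_lt_e₁, neg_lt_neg P.e₃_lt_e₂, fun u => ?_⟩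
  rw [cubic_eq]
  push_cast
  ring

end RectPeriods

end

theorem mainTheorem10 (P : RectPeriods) :
    ∃ u₀ u₁ u₂ : ℝ, P.AreBranchingPoints u₀ u₁ u₂ ∧
      (∀ μ ∈ P.hermitSpectrum, Module.finrank ℂ (P.hermitEigenspace μ) = 1) ∧
      P.hermitSpectrum = P.periodicEigenvalues 2 ∧
      P.hermitSpectrum =
        {u : ℂ | (P.halfTrace u = 1 ∨ P.halfTrace u = -1) ∧ HasDerivAt P.halfTrace 0 u} ∧
      (∃ lam : ℕ → ℝ, StrictMono lam ∧
        P.hermitSpectrum = Set.range (fun s => (lam s : ℂ)) ∧ ∀ s, u₂ < lam s) ∧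
      P.periodicEigenvalues 1 = {(u₀ : ℂ), (u₁ : ℂ), (u₂ : ℂ)} ∧
      (∀ u : ℝ, u₂ ≤ u → ∃ s ∈ Set.Icc (-1 : ℝ) 1, P.halfTrace (u : ℂ) = (s : ℂ)) := by
  obtain ⟨lam, hmono, hrange, hlt⟩ := P.exists_sequence
  refine ⟨-P.e₁, -P.e₂, -P.e₃, P.areBranchingPoints,
    fun μ hμ => P.finrank_hermitEigenspace hμ, ?_, ?_, ⟨lam, hmono, ?_, hlt⟩,
    P.periodicEigenvalues_one_eq, fun u hu => P.halfTrace_mem_Icc hu⟩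
  · rw [P.hermitSpectrum_eq, P.periodicEigenvalues_two]
  · rw [P.hermitSpectrum_eq, P.setOf_halfTrace_eq]
  · rw [P.hermitSpectrum_eq, hrange]
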